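/- Let $T$ be an infinite compact metric space, $h\colon T\to T$ a minimal homeomorphism, and $\mathrm{C}^*(\mathbb{Z},T,h)$ the crossed product, generated by $C(T)$ and a unitary $u$ with $ufu^*=f\circ h^{-1}$. For a closed set $S\subset T$ with nonempty interior, let $A_S$ be the $\mathrm{C}^*$-subalgebra generated by $C(T)$ and $\{ug: g\in C(T),\ g|_S=0\}$. For $s\in S$ let $\lambda_S(s)=\min\{n>0:h^n(s)\in S\}$, let $n_1^S<\dots<n_{l(S)}^S$ be the (finitely many) values of $\lambda_S$ on $S$, and put $X_i^S=\overline{\lambda_S^{-1}(n_i^S)}$, $Y_i^S=X_i^S\setminus\lambda_S^{-1}(n_i^S)$. For $x\in S$ and $N\ge 1$, say that indices $i_1,\dots,i_q$ and the points $x_j=h^{\beta_{j-1}}(x)$, where $\beta_j=n_{i_1}^S+\dots+n_{i_j}^S$ and $\beta_0=0$, are the successive visits of $x$ to $S$ up to time $N$ if $\beta_q=N$; for $1\le k\le N$, $h^k(x)\in S$ if and only if $k=\beta_j$ for some $1\le j\le q$; and $x_j\in X_{i_j}^S\setminus Y_{i_j}^S$ for $1\le j\le q$. A recursive subhomogeneous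 (RSH) algebra with compact metric base spaces $X_1,\dots,X_l$, closed sets $Y_i\subset X_i$ with $Y_1=\varnothing$, and sizes $n_i\geq 1$ is an iterated pullback $A^{(l)}$, where $A^{(1)}=C(X_1,M_{n_1})$ and $A^{(i+1)}=\{(a,f)\in A^{(i)}\oplus C(X_{i+1},M_{n_{i+1}}):\varphi_i(a)=f|_{Y_{i+1}}\}$ for unital $*$-homomorphisms $\varphi_i\colon A^{(i)}\to C(Y_{i+1},M_{n_{i+1}})$. It is diagonal subhomogeneous (DSH) if for all $i$ and $y\in Y_{i+1}$ there are points $x_j\in X_{i_j}\setminus Y_{i_j}$ with $i_j\le i$, $1\le j\le t$, such that $\varphi_i(f)(y)=\operatorname{diag}(f_{i_1}(x_1),\dots,f_{i_t}(x_t))$ for all $f\in A^{(i)}$; then $y$ is said to decompose into $x_1,\dots,x_t$. A unital $*$-homomorphism $\psi\colon A_1\to A_2$ of DSH algebras is diagonal if for every $i$ and every $x$ in the $i$-th base space of $A_2$ there are points $x_1,\dots,x_t$ in the base spaces of $A_1$ with indices $i_1,\dots,i_t$ such that $\psi(f)_i(x)=\operatorname{diag}(f_{i_1}(x_1),\dots,f_{i_t}(x_t))$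 for all $f\in A_1$; then $x$ is said to decompose into $x_1,\dots,x_t$ under $\psi$. **Lemma.** Let $R\subset S\subset T$ be closed sets with nonempty interior. Then $A_S\subset A_R$. For $Q\in\{R,S\}$ there are a DSH algebra $D_Q$ of length $l(Q)$ with base spaces $X_i^Q$, closed subsets $Y_i^Q$ and sizes $n_i^Q$, in which each $y\in Y_i^Q$ decomposes into its successive visits to $Q$ up to time $n_i^Q$, and a $*$-isomorphism $\gamma_Q\colon A_Q\to D_Q$ such that, for all $i$, $$\gamma_Q(f)_i=\operatorname{diag}\big(f\circ h|_{X_i^Q},\dots,f\circ h^{n_i^Q}|_{X_i^Q}\big)$$ for $f\in C(T)$ and, for $g\in C(T)$ with $g|_Q=0$, $\gamma_Q(ug)_i$ has the entries $g\circ h|_{X_i^Q},\dots,g\circ h^{n_i^Q-1}|_{X_i^Q}$ down the first subdiagonal and zeros elsewhere. Under these identifications the inclusion $A_S\hookrightarrow A_R$ is a diagonal map $\psi\colon D_S\to D_R$. Moreover, for every $i$ and every $x\in X_i^R\setminus Y_i^R$ (that is, $x\in R$ with first return time to $R$ equal to $n_i^R$), the successive visits of $x$ to $S$ up to time $n_i^R$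 exist, and $x$ decomposes into them under $\psi$. -/

import Mathlib

open scoped ENNReal

universe u v

/-! ### Block diagonal matrices -/

/-- `M = diag(B_1, …, B_t)`: the sizes `m k` of the blocks add up to `n`, and `M` is the block
diagonal matrix with blocks `B k`, in this order, down the diagonal. -/
def IsBlockDiag {n t : ℕ} (M : Matrix (Fin n) (Fin n) ℂ) (m : Fin t → ℕ)
    (B : ∀ k, Matrix (Fin (m k)) (Fin (m k)) ℂ) : Prop :=
  ∃ hsum : ∑ k, m k = n,
    M = Matrix.reindex (finSigmaFinEquiv.trans (finCongr hsum))
      (finSigmaFinEquiv.trans (finCongr hsum)) (Matrix.blockDiagonal' B)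

/-! ### Recursive subhomogeneous algebras, DSH algebras and diagonal maps -/

/-- The base data of a decomposition of length `l`: base spaces `X i`, subsets `Y i ⊆ X i` and
matrix sizes `n i` (indices start at `0`). -/
structure RSHBase where
  l : ℕ
  X : Fin l → Type u
  metric : ∀ i, MetricSpace (X i)
  Y : ∀ i, Set (X i)
  n : Fin l → ℕ

attribute [instance] RSHBase.metric

namespace RSHBase

/-- `C(X_i, M_{n_i})`. -/
abbrev C (B : RSHBase.{u}) (i : Fin B.l) : Type u :=
  C(B.X i, Matrix (Fin (B.n i)) (Fin (B.n i)) ℂ)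

/-- `C(Y_i, M_{n_i})`. -/
abbrev CY (B : RSHBase.{u}) (i : Fin B.l) : Type u :=
  C(B.Y i, Matrix (Fin (B.n i)) (Fin (B.n i)) ℂ)

/-- The direct sum of `C(X_j, M_{n_j})` over the indices `j` preceding `i`. -/
abbrev Below (B : RSHBase.{u}) (i : Fin B.l) : Type u :=
  ∀ j : {j : Fin B.l // j < i}, B.C j.1

/-- The direct sum of all `C(X_j, M_{n_j})`. -/
abbrev Total (B : RSHBase.{u}) : Type u := ∀ j : Fin B.l, B.C j

/-- Truncation of a tuple over the indices below `i` to the indices below `j`, for `j < i`. -/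
def truncBelow (B : RSHBase.{u}) {i j : Fin B.l} (hj : j < i) (f : B.Below i) : B.Below j :=
  fun k => f ⟨k.1, k.2.trans hj⟩

/-- Truncation of a full tuple to the indices below `i`. -/
def truncTotal (B : RSHBase.{u}) (i : Fin B.l) (f : B.Total) : B.Below i := fun k => f k.1

end RSHBase

/-- A recursive subhomogeneous decomposition over the base data `B`. Here `stage i` is the algebra
obtained from all the indices before `i`, and `φ i` is the unital `*`-homomorphism from it to
`C(Y_i, M_{n_i})` that is used to attach `C(X_i, M_{n_i})`. As `Y` is empty at the first index,
nothing is imposed there and the first algebra is all of `C(X, M_n)`. -/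
structure RSHDecomp (B : RSHBase.{u}) where
  length_pos : 0 < B.l
  size_pos : ∀ i, 0 < B.n i
  compact_X : ∀ i, CompactSpace (B.X i)
  closed_Y : ∀ i, IsClosed (B.Y i)
  Y_first : ∀ i : Fin B.l, i.1 = 0 → B.Y i = ∅
  stage : ∀ i : Fin B.l, StarSubalgebra ℂ (B.Below i)
  φ : ∀ i : Fin B.l, stage i →⋆ₐ[ℂ] B.CY i
  mem_stage : ∀ (i : Fin B.l) (f : B.Below i), f ∈ stage i ↔
    ∀ (j : Fin B.l) (hj : j < i), ∃ hf : B.truncBelow hj f ∈ stage j,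
      ∀ y : B.Y j, φ j ⟨B.truncBelow hj f, hf⟩ y = f ⟨j, hj⟩ y.1

namespace RSHDecomp

/-- The recursive subhomogeneous algebra given by a decomposition (the last iterated pullback). -/
noncomputable def algebra {B : RSHBase.{u}} (D : RSHDecomp B) : StarSubalgebra ℂ B.Total where
  carrier := {f | ∀ i : Fin B.l, ∃ hf : B.truncTotal i f ∈ D.stage i,
    ∀ y : B.Y i, D.φ i ⟨B.truncTotal i f, hf⟩ y = f i y.1}
  mul_mem' {f g} hf hg i := by
    obtain ⟨h₁, e₁⟩ := hf i
    obtain ⟨h₂, e₂⟩ := hg i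
    refine ⟨mul_mem h₁ h₂, fun y => ?_⟩
    have := congrArg (fun F : B.CY i => F y)
      (map_mul (D.φ i) ⟨B.truncTotal i f, h₁⟩ ⟨B.truncTotal i g, h₂⟩)
    refine this.trans ?_
    simp only [ContinuousMap.mul_apply, Pi.mul_apply, e₁, e₂]
  add_mem' {f g} hf hg i := by
    obtain ⟨h₁, e₁⟩ := hf i
    obtain ⟨h₂, e₂⟩ := hg i
    refine ⟨add_mem h₁ h₂, fun y => ?_⟩
    have := congrArg (fun F : B.CY i => F y)
      (map_add (D.φ i) ⟨B.truncTotal i f, h₁⟩ ⟨B.truncTotal i g, h₂⟩)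
    refine this.trans ?_
    simp only [ContinuousMap.add_apply, Pi.add_apply, e₁, e₂]
  algebraMap_mem' c i := by
    refine ⟨algebraMap_mem (D.stage i) c, fun y => ?_⟩
    exact congrArg (fun F : B.CY i => F y) (AlgHomClass.commutes (D.φ i) c)
  star_mem' {f} hf i := by
    obtain ⟨h₁, e₁⟩ := hf i
    refine ⟨star_mem h₁, fun y => ?_⟩
    have := congrArg (fun F : B.CY i => F y) (map_star (D.φ i) ⟨B.truncTotal i f, h₁⟩)
    refine this.trans ?_
    simp only [ContinuousMap.star_apply, Pi.star_apply, e₁]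

/-- The point `y ∈ Y_i` decomposes into the points `x 1, …, x t`, which lie in the base spaces
with indices `idx 1, …, idx t` before `i` and outside the corresponding sets `Y`. -/
def DecomposesInto {B : RSHBase.{u}} (D : RSHDecomp B) (i : Fin B.l) (y : B.Y i) {t : ℕ}
    (idx : Fin t → Fin B.l) (x : ∀ k, B.X (idx k)) : Prop :=
  ∃ hidx : ∀ k, idx k < i, (∀ k, x k ∉ B.Y (idx k)) ∧
    ∀ f : D.stage i, IsBlockDiag (D.φ i f y) (fun k => B.n (idx k))
      (fun k => f.1 ⟨idx k, hidx k⟩ (x k))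

/-- The decomposition is that of a diagonal subhomogeneous algebra. -/
def IsDSH {B : RSHBase.{u}} (D : RSHDecomp B) : Prop :=
  ∀ (i : Fin B.l) (y : B.Y i), ∃ (t : ℕ) (idx : Fin t → Fin B.l) (x : ∀ k, B.X (idx k)),
    D.DecomposesInto i y idx x

/-- The point `z` of a base space of `D₂` decomposes into `x 1, …, x t` under `ψ`. -/
def MapDecomposesInto {B₁ : RSHBase.{u}} {B₂ : RSHBase.{v}} {D₁ : RSHDecomp B₁}
    {D₂ : RSHDecomp B₂} (ψ : D₁.algebra →⋆ₐ[ℂ] D₂.algebra) (i : Fin B₂.l) (z : B₂.X i) {t : ℕ}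
    (idx : Fin t → Fin B₁.l) (x : ∀ k, B₁.X (idx k)) : Prop :=
  ∀ f : D₁.algebra, IsBlockDiag ((ψ f).1 i z) (fun k => B₁.n (idx k))
    (fun k => f.1 (idx k) (x k))

/-- Diagonal `*`-homomorphisms between algebras with given decompositions. -/
def IsDiagonalMap {B₁ : RSHBase.{u}} {B₂ : RSHBase.{v}} {D₁ : RSHDecomp B₁}
    {D₂ : RSHDecomp B₂} (ψ : D₁.algebra →⋆ₐ[ℂ] D₂.algebra) : Prop :=
  ∀ (i : Fin B₂.l) (z : B₂.X i), ∃ (t : ℕ) (idx : Fin t → Fin B₁.l) (x : ∀ k, B₁.X (idx k)),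
    MapDecomposesInto ψ i z idx x

end RSHDecomp

/-! ### The crossed product of a homeomorphism -/

/-- The separable Hilbert space `ℓ²(ℤ)`. -/
abbrev HilbertZ : Type := lp (fun _ : ℤ => ℂ) 2

/-- The automorphism `σ(f) = f ∘ h⁻¹` of `C(T)`. -/
noncomputable def shift {T : Type u} [TopologicalSpace T] (h : T ≃ₜ T) (f : C(T, ℂ)) : C(T, ℂ) :=
  f.comp (h.symm : C(T, T))

/-- Covariant representations `(π, v)` of `(C(T), σ)` on a separable infinite-dimensional Hilbert
space: `π` is a unital `*`-representation, `v` is unitary and `v π(f) v* = π(f ∘ h⁻¹)`. -/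
structure CovariantRep {T : Type u} [TopologicalSpace T] (h : T ≃ₜ T) where
  π : C(T, ℂ) →⋆ₐ[ℂ] (HilbertZ →L[ℂ] HilbertZ)
  v : unitary (HilbertZ →L[ℂ] HilbertZ)
  covariant : ∀ f, (v : HilbertZ →L[ℂ] HilbertZ) * π f * star (v : HilbertZ →L[ℂ] HilbertZ) =
    π (shift h f)

instance : Nontrivial HilbertZ :=
  ⟨⟨lp.single 2 (0 : ℤ) (1 : ℂ), 0, fun e => by
    have := congrArg (fun x : HilbertZ => x 0) e
    simp at this⟩⟩

/-- The C*-algebra of bounded families of operators indexed by the covariant representations,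
with the supremum norm. -/
def CovariantFamilies {T : Type u} [TopologicalSpace T] (h : T ≃ₜ T) : Type u :=
  lp (fun _ : CovariantRep h => HilbertZ →L[ℂ] HilbertZ) ∞

noncomputable instance {T : Type u} [TopologicalSpace T] (h : T ≃ₜ T) :
    NormedRing (CovariantFamilies h) :=
  inferInstanceAs (NormedRing (lp (fun _ : CovariantRep h => HilbertZ →L[ℂ] HilbertZ) ∞))

noncomputable instance {T : Type u} [TopologicalSpace T] (h : T ≃ₜ T) :
    StarRing (CovariantFamilies h) :=
  inferInstanceAs (StarRing (lp (fun _ : CovariantRep h => HilbertZ →L[ℂ] HilbertZ) ∞))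

noncomputable instance {T : Type u} [TopologicalSpace T] (h : T ≃ₜ T) :
    NormedAlgebra ℂ (CovariantFamilies h) :=
  inferInstanceAs (NormedAlgebra ℂ (lp (fun _ : CovariantRep h => HilbertZ →L[ℂ] HilbertZ) ∞))

noncomputable instance {T : Type u} [TopologicalSpace T] (h : T ≃ₜ T) :
    CStarAlgebra (CovariantFamilies h) where
  toCompleteSpace := inferInstanceAs (CompleteSpace (lp (fun _ : CovariantRep h => HilbertZ →L[ℂ] HilbertZ) ∞))
  toCStarRing := inferInstanceAs (CStarRing (lp (fun _ : CovariantRep h => HilbertZ →L[ℂ] HilbertZ) ∞))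
  toStarModule := inferInstanceAs (StarModule ℂ (lp (fun _ : CovariantRep h => HilbertZ →L[ℂ] HilbertZ) ∞))

/-- The universal representation of `C(T)`: `f ↦ (π(f))_{(π, v)}`. -/
noncomputable def universalRep {T : Type u} [TopologicalSpace T] [CompactSpace T] (h : T ≃ₜ T) :
    C(T, ℂ) →⋆ₐ[ℂ] CovariantFamilies h where
  toFun f := ⟨fun p => p.π f, memℓp_infty ⟨‖f‖, by
    rintro _ ⟨p, rfl⟩
    exact NonUnitalStarAlgHom.norm_apply_le p.π f⟩⟩
  map_one' := by refine lp.ext (funext fun p => ?_); exact map_one p.π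
  map_mul' f g := by refine lp.ext (funext fun p => ?_); exact map_mul p.π f g
  map_zero' := by refine lp.ext (funext fun p => ?_); exact map_zero p.π
  map_add' f g := by refine lp.ext (funext fun p => ?_); exact map_add p.π f g
  commutes' c := by refine lp.ext (funext fun p => ?_); exact AlgHomClass.commutes p.π c
  map_star' f := by refine lp.ext (funext fun p => ?_); exact map_star p.π f

/-- The universal unitary `(v)_{(π, v)}`. -/
noncomputable def universalUnitary {T : Type u} [TopologicalSpace T] (h : T ≃ₜ T) :
    CovariantFamilies h :=
  ⟨fun p => p.v, memℓp_infty ⟨1, by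
    rintro _ ⟨p, rfl⟩
    exact (CStarRing.norm_coe_unitary p.v).le⟩⟩

/-- The (full) crossed product `C*(ℤ, T, h)`, for `T` compact metric: the C*-algebra generated by
the universal covariant pair, that is, the completion of the `*`-algebra generated by `C(T)` and
the implementing unitary in the supremum of the norms from all covariant representations. As
`C(T)` is separable, all norms are attained on a separable infinite-dimensional space. -/
noncomputable def crossedProduct {T : Type u} [MetricSpace T] [CompactSpace T] (h : T ≃ₜ T) :
    StarSubalgebra ℂ (CovariantFamilies h) :=
  (StarAlgebra.adjoin ℂ
    (Set.range (universalRep h) ∪ {universalUnitary h})).topologicalClosure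

/-- The canonical embedding of `C(T)` in the crossed product. -/
noncomputable def crossedι {T : Type u} [MetricSpace T] [CompactSpace T] (h : T ≃ₜ T)
    (f : C(T, ℂ)) : crossedProduct h :=
  ⟨universalRep h f, StarSubalgebra.le_topologicalClosure _
    (StarAlgebra.subset_adjoin ℂ _ (Or.inl ⟨f, rfl⟩))⟩

/-- The canonical unitary `u` of the crossed product. -/
noncomputable def crossedU {T : Type u} [MetricSpace T] [CompactSpace T] (h : T ≃ₜ T) :
    crossedProduct h :=
  ⟨universalUnitary h, StarSubalgebra.le_topologicalClosure _
    (StarAlgebra.subset_adjoin ℂ _ (Or.inr rfl))⟩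

/-- The orbit-breaking subalgebra `A_S`: the C*-subalgebra of the crossed product generated by
`f` and `u g`, where `f, g ∈ C(T)` and `g` vanishes on `S`. -/
noncomputable def orbitBreaking {T : Type u} [MetricSpace T] [CompactSpace T] (h : T ≃ₜ T)
    (S : Set T) : StarSubalgebra ℂ (crossedProduct h) :=
  (StarAlgebra.adjoin ℂ (Set.range (crossedι h) ∪
    {a | ∃ g : C(T, ℂ), (∀ s ∈ S, g s = 0) ∧ a = crossedU h * crossedι h g})).topologicalClosure

/-- The generator `f` of `A_S`. -/
noncomputable def genF {T : Type u} [MetricSpace T] [CompactSpace T] (h : T ≃ₜ T)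
    (S : Set T) (f : C(T, ℂ)) : orbitBreaking h S :=
  ⟨crossedι h f, StarSubalgebra.le_topologicalClosure _
    (StarAlgebra.subset_adjoin ℂ _ (Or.inl ⟨f, rfl⟩))⟩

/-- The generator `u g` of `A_S`, for `g` vanishing on `S`. -/
noncomputable def genU {T : Type u} [MetricSpace T] [CompactSpace T] (h : T ≃ₜ T)
    (S : Set T) (g : C(T, ℂ)) (hg : ∀ s ∈ S, g s = 0) : orbitBreaking h S :=
  ⟨crossedU h * crossedι h g, StarSubalgebra.le_topologicalClosure _
    (StarAlgebra.subset_adjoin ℂ _ (Or.inr ⟨g, hg, rfl⟩))⟩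

/-! ### Minimality, return times and the base spaces of `A_S` -/

/-- `h` is minimal: the only closed sets `F` with `h(F) = F` are `∅` and `T`. -/
def IsMinimalHomeo {T : Type u} [TopologicalSpace T] (h : T ≃ₜ T) : Prop :=
  ∀ F : Set T, IsClosed F → h '' F = F → F = ∅ ∨ F = Set.univ

/-- The first return time `min {n > 0 : hⁿ(s) ∈ S}`. -/
noncomputable def returnTime {T : Type u} [TopologicalSpace T] (h : T ≃ₜ T) (S : Set T) (s : T) :
    ℕ :=
  sInf {n : ℕ | 0 < n ∧ h^[n] s ∈ S}

/-- The set of first return times of points of `S` to `S`. -/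
def returnTimes {T : Type u} [TopologicalSpace T] (h : T ≃ₜ T) (S : Set T) : Set ℕ :=
  returnTime h S '' S

/-- The points of `S` with first return time `n`. -/
def returnLevel {T : Type u} [TopologicalSpace T] (h : T ≃ₜ T) (S : Set T) (n : ℕ) : Set T :=
  {s | s ∈ S ∧ returnTime h S s = n}

/-- The base data of `A_S`: `n_1 < n_2 < ⋯ < n_l` are the first return times to `S`, `X_i` is the
closure of the set of points with first return time `n_i`, and `Y_i` is the rest of `X_i`. -/
noncomputable def orbitBase {T : Type u} [MetricSpace T] (h : T ≃ₜ T) (S : Set T) :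
    RSHBase.{u} where
  l := (returnTimes h S).ncard
  X i := closure (returnLevel h S (Nat.nth (· ∈ returnTimes h S) i))
  metric _ := inferInstance
  Y i := {x | (x : T) ∉ returnLevel h S (Nat.nth (· ∈ returnTimes h S) i)}
  n i := Nat.nth (· ∈ returnTimes h S) i

/-- `x`, together with `N`, decomposes into its successive visits to `S`: the indices `idx 1, …,
idx q` satisfy `∑ n_{idx j} = N`; for `1 ≤ k ≤ N` one has `h^k(x) ∈ S` iff `k` is one of the
partial sums `n_{idx 1} + ⋯ + n_{idx j}`; and the `j`-th point is `h^{β}(x)` with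
`β = n_{idx 1} + ⋯ + n_{idx (j-1)}`, which lies in `X_{idx j} \ Y_{idx j}`. -/
structure IsItinerary {T : Type u} [MetricSpace T] (h : T ≃ₜ T) (S : Set T) (x : T) (N : ℕ)
    {q : ℕ} (idx : Fin q → Fin (orbitBase h S).l) (pts : ∀ j, (orbitBase h S).X (idx j)) :
    Prop where
  sum_eq : ∑ j, (orbitBase h S).n (idx j) = N
  visits : ∀ k, 1 ≤ k → k ≤ N →
    (h^[k] x ∈ S ↔ ∃ j, k = ∑ m ∈ Finset.Iic j, (orbitBase h S).n (idx m))
  pts_eq : ∀ j, Subtype.val (pts j) = h^[∑ m ∈ Finset.Iio j, (orbitBase h S).n (idx m)] x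
  pts_notMem : ∀ j, pts j ∉ (orbitBase h S).Y (idx j)

/-- `γ : A_S ≅ D` is the canonical identification of `A_S` with an algebra of matrix-valued
functions: `γ(f)_i = diag(f ∘ h, …, f ∘ h^{n_i})`, and `γ(u g)_i` has the functions
`g ∘ h, …, g ∘ h^{n_i - 1}` on the first subdiagonal and `0` elsewhere. -/
structure IsCanonicalIso {T : Type u} [MetricSpace T] [CompactSpace T] (h : T ≃ₜ T) (S : Set T)
    (D : RSHDecomp (orbitBase h S)) (γ : orbitBreaking h S ≃⋆ₐ[ℂ] D.algebra) : Prop where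
  apply_f : ∀ (f : C(T, ℂ)) (i : Fin (orbitBase h S).l) (x : (orbitBase h S).X i),
    (γ (genF h S f)).1 i x =
      Matrix.diagonal fun a : Fin ((orbitBase h S).n i) => f (h^[a.1 + 1] (Subtype.val x))
  apply_ug : ∀ (g : C(T, ℂ)) (hg : ∀ s ∈ S, g s = 0) (i : Fin (orbitBase h S).l)
    (x : (orbitBase h S).X i),
    (γ (genU h S g hg)).1 i x = Matrix.of fun a b : Fin ((orbitBase h S).n i) =>
      if a.1 = b.1 + 1 then g (h^[b.1 + 1] (Subtype.val x)) else 0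

/-- `D` is the decomposition of `A_S` in which each `y ∈ Y_i` decomposes into its successive visits
to `S` up to time `n_i`. -/
def IsOrbitDecomp {T : Type u} [MetricSpace T] (h : T ≃ₜ T) (S : Set T)
    (D : RSHDecomp (orbitBase h S)) : Prop :=
  ∀ (i : Fin (orbitBase h S).l) (y : (orbitBase h S).Y i),
    ∃ (q : ℕ) (idx : Fin q → Fin (orbitBase h S).l) (pts : ∀ j, (orbitBase h S).X (idx j)),
      IsItinerary h S (Subtype.val y.1) ((orbitBase h S).n i) idx pts ∧
        D.DecomposesInto i y idx pts

/-! ### Integer iterates, visits and return times -/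

section Dynamics

variable {T : Type u}

/-! The elements of `A_S` are the finite sums `∑ u^k f_k` in which `f_k` vanishes at `t` whenever
passing from `t` to `h^k t` crosses `S`. By minimality and compactness some `N` bounds all gaps
between visits to `R`, hence to `S`, so only `|k| < N` contributes.

Cutting orbits at their visits to `S` splits `T` into towers: each `t` is `h^c x` for exactly one `x
∈ S` and one `c` between `1` and the return time of `x`. On `ℓ²` of an orbit, the sum has entry
`f_{a-b}(h^b x)` at `(a, b)`, and the vanishing condition says that this matrix is block diagonal,
with one block per return segment. The blocks are the matrix-valued functions of the subhomogeneous
picture. Conversely, `coef` reads the `f_k` off the blocks, and matrix product and adjoint become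
those of the crossed product (`coef_mul`, `coef_star`). A point of `Y_i` returns before time `n_i`,
so its segment of length `n_i` splits into shorter ones (`base_lt`, `isBlockDiag_orbitMatrix`); the
pullback condition `Compat` asks that the `i`-th function take this block diagonal value there, and
it makes the `f_k` continuous (`continuousOn_coef`).

The resulting map `toCrossed` is injective with closed range, because orbit representations bound
each `‖f_k‖` by the norm of the sum (`norm_le_norm_polySum`). Its range contains the generators of
`A_S`, and lies in `A_S` because `u^k f_k` is a limit of products of generators (`uPow_mul_mem`).

For `R ⊆ S`, the inclusion keeps the coefficients `f_k` and regroups them along the longer return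
segments of `R`. Each of these is cut by its visits to `S`, which is the diagonal form of the map.
-/

theorem zpow_add_apply [TopologicalSpace T] (h : T ≃ₜ T) (a b : ℤ) (x : T) :
    (h ^ (a + b)) x = (h ^ a) ((h ^ b) x) := by
  rw [zpow_add]; rfl

theorem zpow_zero_apply [TopologicalSpace T] (h : T ≃ₜ T) (x : T) : (h ^ (0 : ℤ)) x = x := by
  rw [zpow_zero]; rfl

theorem zpow_natCast_apply [TopologicalSpace T] (h : T ≃ₜ T) (n : ℕ) (x : T) :
    (h ^ (n : ℤ)) x = h^[n] x := by
  induction n generalizing x with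
  | zero => exact zpow_zero_apply h x
  | succ n ih =>
    rw [Nat.cast_succ, zpow_add_apply, ih, Function.iterate_succ_apply, zpow_one]

/-- `S` is closed and meets every orbit segment of length `N`. -/
structure Visits [TopologicalSpace T] (h : T ≃ₜ T) (S : Set T) (N : ℕ) : Prop where
  closed : IsClosed S
  exists_visit : ∀ t : T, ∃ j : ℕ, j < N ∧ (h ^ (j : ℤ)) t ∈ S

theorem IsMinimalHomeo.exists_visits [TopologicalSpace T] [CompactSpace T] [Nonempty T]
    {h : T ≃ₜ T} (hmin : IsMinimalHomeo h) {S : Set T} (hS : IsClosed S)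
    (hne : (interior S).Nonempty) : ∃ N, Visits h S N := by
  set U := interior S with hU
  let V : ℕ → Set T := fun n => {t | ∃ j : ℕ, j < n ∧ (h ^ (j : ℤ)) t ∈ U}
  have hVo : ∀ n, IsOpen (V n) := by
    intro n
    have : V n = ⋃ j ∈ Set.Iio n, (h ^ (j : ℤ)) ⁻¹' U := by
      ext t; simp [V]
    rw [this]
    exact isOpen_biUnion fun j _ => isOpen_interior.preimage (h ^ (j : ℤ)).continuous
  have hVm : Monotone V := fun a b hab t ⟨j, hj, ht⟩ => ⟨j, hj.trans_le hab, ht⟩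
  -- Starting at time `-m` rather than `0` makes the intersection consist of whole orbits avoiding
  -- `U`, a set with `h(F) = F` to which minimality applies.
  let F : ℕ → Set T := fun m => {t | ∀ j : ℤ, -m ≤ j → (h ^ j) t ∉ U}
  have hFc : ∀ m, IsClosed (F m) := by
    intro m
    have : F m = ⋂ j ∈ Set.Ici (-m : ℤ), (h ^ j) ⁻¹' Uᶜ := by
      ext t; simp [F]
    rw [this]
    exact isClosed_biInter fun j _ =>
      (isOpen_interior.isClosed_compl).preimage (h ^ j).continuous
  have hFinter : (⋂ m, F m) = ∅ := by
    have hinv : h '' (⋂ m, F m) = ⋂ m, F m := by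
      ext t
      have key : t ∈ (⋂ m, F m) ↔ ∀ j : ℤ, (h ^ j) t ∉ U := by
        simp only [Set.mem_iInter]
        exact ⟨fun H j => H j.natAbs j (by omega), fun H m j _ => H j⟩
      rw [key]
      constructor
      · rintro ⟨s, hs, rfl⟩ j hj
        have := Set.mem_iInter.1 hs (j + 1).natAbs (j + 1) (by omega)
        rw [zpow_add_apply, zpow_one] at this
        exact this hj
      · intro H
        refine ⟨h.symm t, Set.mem_iInter.2 fun m j _ hj => ?_, h.apply_symm_apply t⟩
        refine H (j - 1) ?_
        rwa [sub_eq_add_neg, zpow_add_apply, zpow_neg_one]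
    rcases hmin _ (isClosed_iInter hFc) hinv with h0 | h1
    · exact h0
    · exfalso
      obtain ⟨x, hx⟩ := hne
      have : x ∈ ⋂ m, F m := h1 ▸ Set.mem_univ x
      exact Set.mem_iInter.1 this 0 0 (by simp) (by rwa [zpow_zero_apply])
  obtain ⟨m, hm⟩ : ∃ m, F m = ∅ := by
    by_contra hcon
    push Not at hcon
    have := IsCompact.nonempty_iInter_of_sequence_nonempty_isCompact_isClosed F
      (fun i t ht j hj => ht j (by push_cast; omega)) hcon (hFc 0).isCompact hFc
    rw [hFinter] at this
    exact Set.not_nonempty_empty this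
  have hcov : ∀ t, ∃ j : ℕ, (h ^ (j : ℤ)) t ∈ U := by
    intro t
    -- Applied to `h^m t`, a visit at some time `≥ -m` becomes a visit of `t` at a time `≥ 0`.
    have : (h ^ (m : ℤ)) t ∉ F m := by rw [hm]; exact Set.notMem_empty _
    simp only [F, Set.mem_ofPred_eq, not_forall, not_not] at this
    obtain ⟨j, hj, hju⟩ := this
    refine ⟨(j + m).toNat, ?_⟩
    rwa [Int.toNat_of_nonneg (by omega), zpow_add_apply]
  obtain ⟨N, hN⟩ : ∃ N, Set.univ ⊆ V N := by
    refine isCompact_univ.elim_directed_cover V hVo ?_ (hVm.directed_le)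
    intro t _
    obtain ⟨j, hj⟩ := hcov t
    exact Set.mem_iUnion.2 ⟨j + 1, j, by omega, hj⟩
  refine ⟨N, hS, fun t => ?_⟩
  obtain ⟨j, hj, hju⟩ := hN (Set.mem_univ t)
  exact ⟨j, hj, interior_subset hju⟩

theorem Visits.mono [TopologicalSpace T] {h : T ≃ₜ T} {R S : Set T} {N : ℕ}
    (V : Visits h R N) (hRS : R ⊆ S) (hS : IsClosed S) : Visits h S N :=
  ⟨hS, fun t => (V.exists_visit t).imp fun _ hj => ⟨hj.1, hRS hj.2⟩⟩

namespace Visits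

variable [TopologicalSpace T] {h : T ≃ₜ T} {S : Set T} {N : ℕ} (V : Visits h S N)
include V

theorem exists_visit_int (t : T) (a : ℤ) : ∃ j : ℤ, a ≤ j ∧ j < a + N ∧ (h ^ j) t ∈ S := by
  obtain ⟨j, hj, hjs⟩ := V.exists_visit ((h ^ a) t)
  exact ⟨j + a, by omega, by omega, by rwa [zpow_add_apply]⟩

theorem returnTime_spec (x : T) :
    0 < returnTime h S x ∧ (h ^ (returnTime h S x : ℤ)) x ∈ S := by
  have hne : {n : ℕ | 0 < n ∧ h^[n] x ∈ S}.Nonempty := by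
    obtain ⟨j, h1, h2, h3⟩ := V.exists_visit_int x 1
    refine ⟨j.toNat, by omega, ?_⟩
    rwa [← zpow_natCast_apply, Int.toNat_of_nonneg (by omega)]
  have := Nat.sInf_mem hne
  rw [zpow_natCast_apply]
  exact this

theorem returnTime_pos (x : T) : 0 < returnTime h S x := (V.returnTime_spec x).1

omit V in
theorem returnTime_le (x : T) {c : ℤ} (hc : 0 < c) (hx : (h ^ c) x ∈ S) :
    (returnTime h S x : ℤ) ≤ c := by
  have : returnTime h S x ≤ c.toNat := Nat.sInf_le ⟨by omega, by
    rwa [← zpow_natCast_apply, Int.toNat_of_nonneg (by omega)]⟩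
  omega

theorem returnTime_le_bound (x : T) : returnTime h S x ≤ N := by
  obtain ⟨j, h1, h2, h3⟩ := V.exists_visit_int x 1
  have := returnTime_le x (by omega) h3
  omega

theorem returnTimes_finite : (returnTimes h S).Finite :=
  (Set.finite_Iic N).subset (by rintro _ ⟨x, _, rfl⟩; exact V.returnTime_le_bound x)

/-- The base point is the last visit strictly before `t`. Levels are counted from `1` up to the
return time, in agreement with `diag(f ∘ h, …, f ∘ h^n)`. -/
theorem exists_tower (t : T) : ∃ p : T × ℤ, p.1 ∈ S ∧ 1 ≤ p.2 ∧ p.2 ≤ returnTime h S p.1 ∧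
    t = (h ^ p.2) p.1 := by
  have hex : ∃ c : ℕ, 1 ≤ c ∧ (h ^ (-(c : ℤ))) t ∈ S := by
    obtain ⟨j, h1, h2, h3⟩ := V.exists_visit_int t (-N)
    exact ⟨(-j).toNat, by omega, by rwa [Int.toNat_of_nonneg (by omega), neg_neg]⟩
  classical
  obtain ⟨h1, h2⟩ := Nat.find_spec hex
  set c := Nat.find hex with hc
  refine ⟨((h ^ (-(c : ℤ))) t, c), h2, by dsimp only; exact_mod_cast h1, ?_, ?_⟩
  -- A return before level `c` would be a visit closer to `t`, against the minimality of `c`.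
  · by_contra! hlt
    have hs := (V.returnTime_spec ((h ^ (-(c : ℤ))) t))
    dsimp only at hlt
    set r := returnTime h S ((h ^ (-(c : ℤ))) t)
    refine Nat.find_min hex (m := c - r) (by omega) ⟨by omega, ?_⟩
    have := hs.2
    rw [← zpow_add_apply] at this
    convert this using 3
    omega
  · dsimp only
    rw [← zpow_add_apply, add_neg_cancel, zpow_zero_apply]

-- If `c < c'`, then `x = h^(c'-c) x'` is a return of `x'` before level `c'`, which is at most the
-- first return time.
omit V in
theorem tower_unique {x x' : T} (hx : x ∈ S) (hx' : x' ∈ S) {c c' : ℤ} (h1 : 1 ≤ c)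
    (h2 : c ≤ returnTime h S x) (h1' : 1 ≤ c') (h2' : c' ≤ returnTime h S x')
    (e : (h ^ c) x = (h ^ c') x') : x = x' ∧ c = c' := by
  have aux : ∀ {x x' : T} (_ : x ∈ S) (_ : x' ∈ S) {c c' : ℤ} (_ : 1 ≤ c)
    (_ : c ≤ returnTime h S x) (_ : 1 ≤ c') (_ : c' ≤ returnTime h S x')
    (_ : (h ^ c) x = (h ^ c') x') (_ : c ≤ c'), x = x' ∧ c = c' := by
    intro x x' hx hx' c c' h1 h2 h1' h2' e hle
    have e' : x = (h ^ (c' - c)) x' := by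
      have := congrArg (h ^ (-c)) e
      rw [← zpow_add_apply, ← zpow_add_apply, neg_add_cancel, zpow_zero_apply] at this
      rw [this]; congr 2; ring
    have hcc : c = c' := by
      by_contra hne
      have := returnTime_le (h := h) (S := S) x' (c := c' - c) (by omega) (e' ▸ hx)
      omega
    subst hcc
    rw [sub_self, zpow_zero_apply] at e'
    exact ⟨e', rfl⟩
  rcases le_total c c' with hle | hle
  · exact aux hx hx' h1 h2 h1' h2' e hle
  · obtain ⟨e1, e2⟩ := aux hx' hx h1' h2' h1 h2 e.symm hle
    exact ⟨e1.symm, e2.symm⟩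

omit V in
theorem notMem_of_lt_returnTime (x : T) {c : ℤ} (hc : 0 < c) (hlt : c < returnTime h S x) :
    (h ^ c) x ∉ S := fun hx => by
  have := returnTime_le x hc hx
  omega

end Visits

end Dynamics

/-! ### The base spaces -/

namespace Visits

variable {T : Type u} [MetricSpace T] {h : T ≃ₜ T} {S : Set T} {N : ℕ}

theorem card_eq (V : Visits h S N)
    (hf : (Set.ofPred (· ∈ returnTimes h S)).Finite) : hf.toFinset.card = (orbitBase h S).l := by
  show _ = (returnTimes h S).ncard
  rw [Set.ncard_eq_toFinset_card _ V.returnTimes_finite]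

theorem n_mem (V : Visits h S N) (i : Fin (orbitBase h S).l) :
    (orbitBase h S).n i ∈ returnTimes h S :=
  Nat.nth_mem_of_lt_card V.returnTimes_finite (by rw [V.card_eq]; exact i.2)

theorem n_lt_iff (V : Visits h S N) {i j : Fin (orbitBase h S).l} :
    (orbitBase h S).n i < (orbitBase h S).n j ↔ i < j :=
  (Nat.nth_strictMonoOn (p := (· ∈ returnTimes h S)) V.returnTimes_finite).lt_iff_lt
    (by rw [V.card_eq]; exact i.2) (by rw [V.card_eq]; exact j.2)

theorem n_pos (V : Visits h S N) (i : Fin (orbitBase h S).l) : 0 < (orbitBase h S).n i := by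
  obtain ⟨x, _, hx⟩ := V.n_mem i
  rw [← hx]; exact V.returnTime_pos x

theorem n_le (V : Visits h S N) (i : Fin (orbitBase h S).l) : (orbitBase h S).n i ≤ N := by
  obtain ⟨x, _, hx⟩ := V.n_mem i
  rw [← hx]; exact V.returnTime_le_bound x

theorem exists_index (V : Visits h S N) {x : T} (hx : x ∈ S) :
    ∃ i : Fin (orbitBase h S).l, (orbitBase h S).n i = returnTime h S x := by
  obtain ⟨i, hi, e⟩ := Nat.exists_lt_card_finite_nth_eq (p := (· ∈ returnTimes h S))
    V.returnTimes_finite (x := returnTime h S x) ⟨x, hx, rfl⟩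
  rw [V.card_eq] at hi
  exact ⟨⟨i, hi⟩, e⟩

/-- The index of the base space determined by the return time of a point of `S`. -/
noncomputable def index (V : Visits h S N) (x : S) : Fin (orbitBase h S).l :=
  (V.exists_index x.2).choose

theorem n_index (V : Visits h S N) (x : S) :
    (orbitBase h S).n (V.index x) = returnTime h S x :=
  (V.exists_index x.2).choose_spec

theorem index_eq (V : Visits h S N) (x : S) {i : Fin (orbitBase h S).l}
    (hi : returnTime h S x = (orbitBase h S).n i) : V.index x = i := by
  have := V.n_index x
  rw [hi] at this
  exact le_antisymm (not_lt.1 fun hlt => ((V.n_lt_iff).2 hlt).ne this.symm)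
    (not_lt.1 fun hlt => ((V.n_lt_iff).2 hlt).ne this)

theorem mem_returnLevel_index (V : Visits h S N) (x : S) :
    (x : T) ∈ returnLevel h S ((orbitBase h S).n (V.index x)) :=
  ⟨x.2, (V.n_index x).symm⟩

/-- A point of `S` as a point of the base space determined by its return time. -/
noncomputable def basePoint (V : Visits h S N) (x : S) : (orbitBase h S).X (V.index x) :=
  ⟨x, subset_closure (V.mem_returnLevel_index x)⟩

/-- A point of a base space, as a point of the ambient space. -/
def toT {i : Fin (orbitBase h S).l} (x : (orbitBase h S).X i) : T := Subtype.val x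

theorem continuous_toT {i : Fin (orbitBase h S).l} :
    Continuous (toT : (orbitBase h S).X i → T) := continuous_subtype_val

/-- Both conditions are closed and hold at points with return time `n_i`, so they pass to the
closure. At points of `Y_i` only the minimality of `n_i` as a return time is lost. -/
theorem base_mem (V : Visits h S N) {i : Fin (orbitBase h S).l} (x : (orbitBase h S).X i) :
    toT x ∈ S ∧ (h ^ ((orbitBase h S).n i : ℤ)) (toT x) ∈ S := by
  have hcl : IsClosed (S ∩ (h ^ ((orbitBase h S).n i : ℤ)) ⁻¹' S) :=
    V.closed.inter (V.closed.preimage (h ^ ((orbitBase h S).n i : ℤ)).continuous)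
  refine closure_minimal ?_ hcl x.2
  rintro y ⟨hy, hr⟩
  refine ⟨hy, ?_⟩
  have := (V.returnTime_spec y).2
  rw [hr] at this
  exact this

theorem notMem_Y_iff (V : Visits h S N) {i : Fin (orbitBase h S).l} (x : (orbitBase h S).X i) :
    x ∉ (orbitBase h S).Y i ↔ returnTime h S (toT x) = (orbitBase h S).n i := by
  show ¬ (toT x ∉ returnLevel h S _) ↔ _
  rw [not_not]
  exact ⟨fun hx => hx.2, fun hx => ⟨(V.base_mem x).1, hx⟩⟩

theorem mem_Y_iff (V : Visits h S N) {i : Fin (orbitBase h S).l} (x : (orbitBase h S).X i) :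
    x ∈ (orbitBase h S).Y i ↔ returnTime h S (toT x) < (orbitBase h S).n i := by
  rw [← not_iff_not, V.notMem_Y_iff, not_lt]
  have := returnTime_le (toT x) (by exact_mod_cast V.n_pos i) (V.base_mem x).2
  omega

/-- Within `X_i`, the set `Y_i` is cut out by a visit at one of the finitely many times strictly
between `0` and `n_i`, and each such condition is closed. -/
theorem isClosed_Y (V : Visits h S N) (i : Fin (orbitBase h S).l) :
    IsClosed ((orbitBase h S).Y i) := by
  have : (orbitBase h S).Y i = ⋃ m ∈ Set.Ioo (0 : ℤ) ((orbitBase h S).n i),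
      (fun x : (orbitBase h S).X i => (h ^ m) (toT x)) ⁻¹' S := by
    ext x
    rw [V.mem_Y_iff]
    simp only [Set.mem_Ioo, Set.mem_iUnion, Set.mem_preimage, exists_prop]
    constructor
    · intro hx
      exact ⟨returnTime h S (toT x), ⟨by exact_mod_cast V.returnTime_pos _, by exact_mod_cast hx⟩,
        (V.returnTime_spec _).2⟩
    · rintro ⟨m, ⟨h1, h2⟩, hm⟩
      have := returnTime_le _ h1 hm
      omega
  rw [this]
  exact (Set.finite_Ioo _ _).isClosed_biUnion fun m _ =>
    V.closed.preimage ((h ^ m).continuous.comp continuous_toT)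

theorem Y_first (V : Visits h S N) (i : Fin (orbitBase h S).l) (hi : i.1 = 0) :
    (orbitBase h S).Y i = ∅ := by
  refine Set.eq_empty_of_forall_notMem fun x hx => ?_
  rw [V.mem_Y_iff, ← V.n_index ⟨toT x, (V.base_mem x).1⟩, V.n_lt_iff] at hx
  have := Fin.lt_def.1 hx
  omega

end Visits

/-! ### Matrix entries with integer indices -/

/-- The entry of a matrix at integer positions, counted from `1`, and `0` out of range. -/
noncomputable def ent {n : ℕ} (M : Matrix (Fin n) (Fin n) ℂ) (a b : ℤ) : ℂ :=
  if H : (1 ≤ a ∧ a ≤ n) ∧ (1 ≤ b ∧ b ≤ n) then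
    M ⟨(a - 1).toNat, by omega⟩ ⟨(b - 1).toNat, by omega⟩ else 0

section ent

variable {n : ℕ} (M M' : Matrix (Fin n) (Fin n) ℂ)

theorem ent_of_not_left {a b : ℤ} (H : ¬ (1 ≤ a ∧ a ≤ n)) : ent M a b = 0 :=
  dif_neg fun h => H h.1

theorem ent_of_not_right {a b : ℤ} (H : ¬ (1 ≤ b ∧ b ≤ n)) : ent M a b = 0 :=
  dif_neg fun h => H h.2

theorem ent_fin (a b : Fin n) : ent M (a + 1) (b + 1) = M a b := by
  rw [ent, dif_pos ⟨⟨by omega, by omega⟩, by omega, by omega⟩]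
  congr <;> omega

theorem exists_fin_eq {a : ℤ} (H : 1 ≤ a ∧ a ≤ n) : ∃ i : Fin n, a = i + 1 :=
  ⟨⟨(a - 1).toNat, by omega⟩, by dsimp only; omega⟩

theorem ent_cases {P : (Matrix (Fin n) (Fin n) ℂ → ℂ) → Prop} (a b : ℤ) (h0 : P fun _ => 0)
    (h1 : ∀ i j : Fin n, P fun M => M i j) : P fun M => ent M a b := by
  by_cases H : (1 ≤ a ∧ a ≤ n) ∧ (1 ≤ b ∧ b ≤ n)
  · obtain ⟨i, rfl⟩ := exists_fin_eq H.1
    obtain ⟨j, rfl⟩ := exists_fin_eq H.2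
    simpa only [ent_fin] using h1 i j
  · simpa only [ent, dif_neg H] using h0

theorem ent_add (a b : ℤ) : ent (M + M') a b = ent M a b + ent M' a b :=
  ent_cases (P := fun e => e (M + M') = e M + e M') a b (by simp) (by simp)

theorem ent_smul (c : ℂ) (a b : ℤ) : ent (c • M) a b = c * ent M a b :=
  ent_cases (P := fun e => e (c • M) = c * e M) a b (by simp) (by simp)

theorem ent_one {a : ℤ} (b : ℤ) (ha : 1 ≤ a ∧ a ≤ n) :
    ent (1 : Matrix (Fin n) (Fin n) ℂ) b a = if b = a then 1 else 0 := by
  obtain ⟨i, rfl⟩ := exists_fin_eq ha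
  by_cases hb : 1 ≤ b ∧ b ≤ n
  · obtain ⟨j, rfl⟩ := exists_fin_eq hb
    simp only [ent_fin, Matrix.one_apply, Fin.ext_iff, add_left_inj, Nat.cast_inj]
  · rw [ent_of_not_left _ hb, if_neg]
    omega

theorem ent_star (a b : ℤ) : ent (star M) a b = star (ent M b a) := by
  by_cases H : (1 ≤ a ∧ a ≤ n) ∧ (1 ≤ b ∧ b ≤ n)
  · obtain ⟨i, rfl⟩ := exists_fin_eq H.1
    obtain ⟨j, rfl⟩ := exists_fin_eq H.2
    simp only [ent_fin, Matrix.star_apply]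
  · rw [ent, dif_neg H, ent, dif_neg fun h => H ⟨h.2, h.1⟩, star_zero]

theorem ent_mul (a b : ℤ) :
    ent (M * M') a b = ∑ c ∈ Finset.Icc (1 : ℤ) n, ent M a c * ent M' c b := by
  by_cases ha : 1 ≤ a ∧ a ≤ n
  swap
  · rw [ent_of_not_left _ ha, Finset.sum_eq_zero]
    intro c _
    rw [ent_of_not_left _ ha, zero_mul]
  by_cases hb : 1 ≤ b ∧ b ≤ n
  swap
  · rw [ent_of_not_right _ hb, Finset.sum_eq_zero]
    intro c _
    rw [ent_of_not_right _ hb, mul_zero]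
  obtain ⟨i, rfl⟩ := exists_fin_eq ha
  obtain ⟨j, rfl⟩ := exists_fin_eq hb
  rw [ent_fin, Matrix.mul_apply]
  refine Finset.sum_bij (fun c _ => ((c : ℕ) : ℤ) + 1) ?_ ?_ ?_ ?_
  · intro c _
    rw [Finset.mem_Icc]; omega
  · intro c _ c' _ hcc
    ext; omega
  · intro c hc
    obtain ⟨k, rfl⟩ := exists_fin_eq (Finset.mem_Icc.1 hc)
    exact ⟨k, Finset.mem_univ _, rfl⟩
  · intro c _
    rw [ent_fin, ent_fin]

theorem continuous_ent (a b : ℤ) : Continuous fun M : Matrix (Fin n) (Fin n) ℂ => ent M a b :=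
  ent_cases (P := Continuous) a b continuous_const
    fun i j => (continuous_apply j).comp (continuous_apply i)

end ent

/-! ### The coefficients of a tuple of matrix-valued functions -/

/-- The orbit segment from `t` to `h ^ k t` passes from a point of `S` to its image under `h`. -/
def Crosses {T : Type u} [TopologicalSpace T] (h : T ≃ₜ T) (S : Set T) (k : ℤ) (t : T) : Prop :=
  ∃ j : ℤ, min 0 k ≤ j ∧ j < max 0 k ∧ (h ^ j) t ∈ S

theorem Crosses.mono {T : Type u} [TopologicalSpace T] {h : T ≃ₜ T} {R S : Set T} (hRS : R ⊆ S)
    {k : ℤ} {t : T} : Crosses h R k t → Crosses h S k t :=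
  fun ⟨j, h1, h2, h3⟩ => ⟨j, h1, h2, hRS h3⟩

namespace Visits

variable {T : Type u} [MetricSpace T] {h : T ≃ₜ T} {S : Set T} {N : ℕ}

theorem crosses_of_le (V : Visits h S N) {k : ℤ} (hk : N ≤ |k|) (t : T) : Crosses h S k t := by
  obtain ⟨j, h1, h2, h3⟩ := V.exists_visit_int t (min 0 k)
  refine ⟨j, h1, ?_, h3⟩
  rcases abs_cases k with ⟨e, _⟩ | ⟨e, _⟩ <;> omega

/-- Leaving the tower downwards passes the base, at relative time `-c`; leaving it upwards passes
the top, at relative time `returnTime - c`. Both lie in `S`, while the levels in between do not. The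
half-open range in `Crosses` counts the top only for upward moves out of it. -/
theorem crosses_iff (V : Visits h S N) {x : T} (hx : x ∈ S) {c : ℤ} (h1 : 1 ≤ c)
    (h2 : c ≤ returnTime h S x) (k : ℤ) :
    Crosses h S k ((h ^ c) x) ↔ ¬ (1 ≤ c + k ∧ c + k ≤ returnTime h S x) := by
  constructor
  · rintro ⟨j, hj1, hj2, hj⟩ ⟨h3, h4⟩
    rw [← zpow_add_apply] at hj
    exact notMem_of_lt_returnTime x (by omega) (by omega) hj
  · intro H
    by_cases h3 : c + k < 1
    · refine ⟨-c, by omega, by omega, ?_⟩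
      rwa [← zpow_add_apply, neg_add_cancel, zpow_zero_apply]
    · refine ⟨returnTime h S x - c, by omega, by omega, ?_⟩
      rw [← zpow_add_apply, sub_add_cancel]
      exact (V.returnTime_spec x).2

/-- The coefficient of `u ^ k` in the element of the crossed product with components `F`. -/
noncomputable def coef (V : Visits h S N) (F : (orbitBase h S).Total) (k : ℤ) (t : T) : ℂ :=
  ent (F (V.index ⟨(V.exists_tower t).choose.1, (V.exists_tower t).choose_spec.1⟩)
      (V.basePoint ⟨(V.exists_tower t).choose.1, (V.exists_tower t).choose_spec.1⟩))
    ((V.exists_tower t).choose.2 + k) (V.exists_tower t).choose.2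

/-- Uniqueness of the tower coordinates makes `coef` independent of the choices in its definition.
-/
theorem coef_tower (V : Visits h S N) (F : (orbitBase h S).Total) (k : ℤ) (x : S) {c : ℤ}
    (h1 : 1 ≤ c) (h2 : c ≤ returnTime h S x) :
    V.coef F k ((h ^ c) (x : T)) = ent (F (V.index x) (V.basePoint x)) (c + k) c := by
  have hs := (V.exists_tower ((h ^ c) (x : T))).choose_spec
  obtain ⟨e1, e2⟩ := tower_unique x.2 hs.1 h1 h2 hs.2.1 hs.2.2.1 hs.2.2.2
  have e3 : (⟨(V.exists_tower ((h ^ c) (x : T))).choose.1, hs.1⟩ : S) = x :=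
    Subtype.ext e1.symm
  rw [coef, e3, ← e2]

theorem ent_congr_point (F : (orbitBase h S).Total) {i j : Fin (orbitBase h S).l} (hij : j = i)
    {z : (orbitBase h S).X i} {w : (orbitBase h S).X j} (e : toT w = toT z) (a b : ℤ) :
    ent (F j w) a b = ent (F i z) a b := by
  subst hij
  rw [show w = z from Subtype.ext e]

theorem coef_base (V : Visits h S N) (F : (orbitBase h S).Total) (k : ℤ)
    {i : Fin (orbitBase h S).l} {z : (orbitBase h S).X i} (hz : z ∉ (orbitBase h S).Y i) {c : ℤ}
    (h1 : 1 ≤ c) (h2 : c ≤ (orbitBase h S).n i) :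
    V.coef F k ((h ^ c) (toT z)) = ent (F i z) (c + k) c := by
  rw [V.notMem_Y_iff] at hz
  have hi := V.index_eq ⟨toT z, (V.base_mem z).1⟩ hz
  rw [V.coef_tower F k ⟨toT z, (V.base_mem z).1⟩ h1 (by rw [hz]; exact h2)]
  exact ent_congr_point F hi rfl _ _

theorem exists_base (V : Visits h S N) (t : T) :
    ∃ (i : Fin (orbitBase h S).l) (z : (orbitBase h S).X i) (c : ℤ),
      z ∉ (orbitBase h S).Y i ∧ 1 ≤ c ∧ c ≤ (orbitBase h S).n i ∧ t = (h ^ c) (toT z) := by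
  obtain ⟨⟨x, c⟩, hx, h1, h2, e⟩ := V.exists_tower t
  refine ⟨V.index ⟨x, hx⟩, V.basePoint ⟨x, hx⟩, c, ?_, h1, ?_, e⟩
  · rw [V.notMem_Y_iff, n_index]; rfl
  · rw [n_index]; exact h2

theorem crosses_base_iff (V : Visits h S N) {i : Fin (orbitBase h S).l}
    {z : (orbitBase h S).X i} (hz : z ∉ (orbitBase h S).Y i) {c : ℤ} (h1 : 1 ≤ c)
    (h2 : c ≤ (orbitBase h S).n i) (k : ℤ) :
    Crosses h S k ((h ^ c) (toT z)) ↔ ¬ (1 ≤ c + k ∧ c + k ≤ (orbitBase h S).n i) := by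
  rw [V.notMem_Y_iff] at hz
  rw [← hz] at h2 ⊢
  exact V.crosses_iff (V.base_mem z).1 h1 h2 k

theorem coef_eq_zero (V : Visits h S N) (F : (orbitBase h S).Total) {k : ℤ} {t : T}
    (ht : Crosses h S k t) : V.coef F k t = 0 := by
  obtain ⟨i, z, c, hz, h1, h2, rfl⟩ := V.exists_base t
  rw [V.coef_base F k hz h1 h2, ent_of_not_left _ ((V.crosses_base_iff hz h1 h2 k).1 ht)]

theorem coef_eq_zero_of_le (V : Visits h S N) (F : (orbitBase h S).Total) {k : ℤ}
    (hk : N ≤ |k|) (t : T) : V.coef F k t = 0 := V.coef_eq_zero F (V.crosses_of_le hk t)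

theorem coef_add (V : Visits h S N) (F G : (orbitBase h S).Total) (k : ℤ) (t : T) :
    V.coef (F + G) k t = V.coef F k t + V.coef G k t := ent_add _ _ _ _

theorem coef_smul (V : Visits h S N) (a : ℂ) (F : (orbitBase h S).Total) (k : ℤ) (t : T) :
    V.coef (a • F) k t = a * V.coef F k t := ent_smul _ _ _ _

theorem coef_one (V : Visits h S N) (k : ℤ) (t : T) :
    V.coef 1 k t = if k = 0 then 1 else 0 := by
  obtain ⟨i, z, c, hz, h1, h2, rfl⟩ := V.exists_base t
  rw [V.coef_base _ k hz h1 h2]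
  refine (ent_one _ ⟨h1, h2⟩).trans ?_
  simp

/-- The entry at `(c + k, c)` of the adjoint is the conjugate of the one at `(c, c + k)`, which is
the coefficient of index `-k` at `h^k t`. If `h^k t` is outside the tower, the reversed segment
crosses `S` too and both sides vanish. -/
theorem coef_star (V : Visits h S N) (F : (orbitBase h S).Total) (k : ℤ) (t : T) :
    V.coef (star F) k t = star (V.coef F (-k) ((h ^ k) t)) := by
  obtain ⟨i, z, c, hz, h1, h2, rfl⟩ := V.exists_base t
  rw [V.coef_base _ k hz h1 h2, ← zpow_add_apply, add_comm k c]
  by_cases hr : 1 ≤ c + k ∧ c + k ≤ (orbitBase h S).n i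
  · rw [V.coef_base _ _ hz hr.1 hr.2, add_neg_cancel_right, ← ent_star]
    rfl
  · rw [ent_of_not_left _ hr, V.coef_eq_zero, star_zero]
    obtain ⟨j, hj1, hj2, hj⟩ := (V.crosses_base_iff hz h1 h2 k).2 hr
    refine ⟨j - k, by omega, by omega, ?_⟩
    rw [← zpow_add_apply] at hj ⊢
    convert hj using 3
    ring

/-- With `b = c + l`, the sum over the middle index `b` of the matrix product is the sum over `l`.
The other `l` leave the tower and contribute zero, and tower heights at most `N` give `|l| < N`. -/
theorem coef_mul (V : Visits h S N) (F G : (orbitBase h S).Total) (k : ℤ) (t : T) :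
    V.coef (F * G) k t =
      ∑ l ∈ Finset.Ioo (-N : ℤ) N, V.coef F (k - l) ((h ^ l) t) * V.coef G l t := by
  obtain ⟨i, z, c, hz, h1, h2, rfl⟩ := V.exists_base t
  rw [V.coef_base _ k hz h1 h2]
  refine (ent_mul _ _ _ _).trans ?_
  have hn := V.n_le i
  refine Finset.sum_bij_ne_zero (fun b _ _ => b - c) ?_ ?_ ?_ ?_
  · intro b hb _
    rw [Finset.mem_Icc] at hb
    rw [Finset.mem_Ioo]
    omega
  · intro b _ _ b' _ _ hbb
    omega
  · intro l hl hne
    have hr : 1 ≤ c + l ∧ c + l ≤ (orbitBase h S).n i := by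
      by_contra hr
      exact hne (by rw [V.coef_base G l hz h1 h2, ent_of_not_left _ hr, mul_zero])
    refine ⟨c + l, Finset.mem_Icc.2 hr, ?_, by ring⟩
    rw [V.coef_base G l hz h1 h2, ← zpow_add_apply, add_comm l c,
      V.coef_base F _ hz hr.1 hr.2, show c + l + (k - l) = c + k by ring] at hne
    exact hne
  · intro b hb _
    rw [Finset.mem_Icc] at hb
    rw [← zpow_add_apply, sub_add_cancel, V.coef_base G _ hz h1 h2, V.coef_base F _ hz hb.1 hb.2,
      show b + (k - (b - c)) = c + k by ring, show c + (b - c) = b by ring]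

end Visits

/-! ### Itineraries and block diagonal form -/

theorem sum_castLE_eq_sum_Iio {q : ℕ} (m : Fin q → ℕ) (k : Fin q) :
    ∑ i : Fin k.1, m (Fin.castLE k.2.le i) = ∑ i ∈ Finset.Iio k, m i := by
  refine Finset.sum_bij (fun i _ => Fin.castLE k.2.le i) ?_ ?_ ?_ ?_
  · intro i _
    rw [Finset.mem_Iio, Fin.lt_def]
    exact i.2
  · intro i _ j _ e
    exact Fin.castLE_injective _ e
  · intro i hi
    exact ⟨⟨i, Fin.lt_def.1 (Finset.mem_Iio.1 hi)⟩, Finset.mem_univ _, rfl⟩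
  · intro i _
    rfl

theorem sum_Iio_add_le {q : ℕ} (m : Fin q → ℕ) {k k' : Fin q} (hk : k < k') :
    ∑ i ∈ Finset.Iio k, m i + m k ≤ ∑ i ∈ Finset.Iio k', m i := by
  rw [add_comm, ← Finset.sum_insert (Finset.notMem_Iio_self)]
  refine Finset.sum_le_sum_of_subset fun i hi => ?_
  rcases Finset.mem_insert.1 hi with rfl | hi
  · exact Finset.mem_Iio.2 hk
  · exact Finset.mem_Iio.2 ((Finset.mem_Iio.1 hi).trans hk)

theorem sum_Iio_fin {q : ℕ} (g : ℕ → ℕ) (j : Fin q) :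
    ∑ m ∈ Finset.Iio j, g m = ∑ m ∈ Finset.range j, g m := by
  rw [← Nat.Iio_eq_range, ← Fin.map_valEmbedding_Iio, Finset.sum_map]
  rfl

theorem sum_Iic_fin {q : ℕ} (g : ℕ → ℕ) (j : Fin q) :
    ∑ m ∈ Finset.Iic j, g m = ∑ m ∈ Finset.range (j + 1), g m := by
  have : Finset.range ((j : ℕ) + 1) = Finset.Iic (j : ℕ) := by ext; simp
  rw [this, ← Fin.map_valEmbedding_Iic, Finset.sum_map]
  rfl

/-- The successive times at which `x` visits `S`, starting at `0`. -/
noncomputable def visitTime {T : Type u} [TopologicalSpace T] (h : T ≃ₜ T) (S : Set T) (x : T) :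
    ℕ → ℕ
  | 0 => 0
  | j + 1 => visitTime h S x j + returnTime h S ((h ^ (visitTime h S x j : ℤ)) x)

theorem visitTime_eq_sum {T : Type u} [TopologicalSpace T] (h : T ≃ₜ T) (S : Set T) (x : T)
    (j : ℕ) : visitTime h S x j =
      ∑ m ∈ Finset.range j, returnTime h S ((h ^ (visitTime h S x m : ℤ)) x) := by
  induction j with
  | zero => rfl
  | succ j ih => rw [Finset.sum_range_succ, ← ih, visitTime]

namespace Visits

variable {T : Type u} [MetricSpace T] {h : T ≃ₜ T} {S : Set T} {N : ℕ}

theorem visitTime_mem (V : Visits h S N) {x : T} (hx : x ∈ S) (j : ℕ) :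
    (h ^ (visitTime h S x j : ℤ)) x ∈ S := by
  cases j with
  | zero => exact (zpow_zero_apply h x).symm ▸ hx
  | succ j =>
    rw [visitTime, Nat.cast_add, add_comm, zpow_add_apply]
    exact (V.returnTime_spec _).2

theorem visitTime_strictMono (V : Visits h S N) (x : T) : StrictMono (visitTime h S x) :=
  strictMono_nat_of_lt_succ fun j => by
    rw [visitTime]
    have := V.returnTime_pos ((h ^ (visitTime h S x j : ℤ)) x)
    omega

theorem exists_visitTime (V : Visits h S N) {x : T} {k : ℕ} (hk : (h ^ (k : ℤ)) x ∈ S)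
    (hk0 : 0 < k) : ∃ j, visitTime h S x (j + 1) = k := by
  have hex : ∃ j, k ≤ visitTime h S x j := ⟨k, (V.visitTime_strictMono x).le_apply⟩
  classical
  have h1 := Nat.find_spec hex
  obtain ⟨j, hj⟩ : ∃ j, Nat.find hex = j + 1 :=
    Nat.exists_eq_succ_of_ne_zero fun h0 => by
      rw [h0, visitTime] at h1
      omega
  have h2 := Nat.find_min hex (m := j) (by omega)
  rw [hj] at h1
  push Not at h2
  refine ⟨j, le_antisymm ?_ h1⟩
  rw [visitTime]
  have := returnTime_le (h := h) (S := S) ((h ^ (visitTime h S x j : ℤ)) x)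
    (c := k - visitTime h S x j) (by omega) (by rwa [← zpow_add_apply, sub_add_cancel])
  omega

/-- As `h^n x` is itself a visit, `n` is one of the visit times, so the return segments fill the
times up to `n` exactly. -/
theorem exists_itinerary (V : Visits h S N) {x : T} (hx : x ∈ S) {n : ℕ} (hn0 : 0 < n)
    (hn : (h ^ (n : ℤ)) x ∈ S) :
    ∃ (q : ℕ) (idx : Fin q → Fin (orbitBase h S).l) (pts : ∀ j, (orbitBase h S).X (idx j)),
      IsItinerary h S x n idx pts := by
  obtain ⟨q, hq⟩ := V.exists_visitTime hn hn0
  let p : ℕ → S := fun j => ⟨(h ^ (visitTime h S x j : ℤ)) x, V.visitTime_mem hx j⟩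
  let g : ℕ → ℕ := fun j => returnTime h S ((h ^ (visitTime h S x j : ℤ)) x)
  have hidx : ∀ j : Fin (q + 1), (orbitBase h S).n (V.index (p j)) = g j :=
    fun j => V.n_index (p j)
  refine ⟨q + 1, fun j => V.index (p j), fun j => V.basePoint (p j), ?_, ?_, ?_, ?_⟩
  · simp only [hidx]
    rw [Fin.sum_univ_eq_sum_range g, ← hq, visitTime_eq_sum]
  · intro k h1 h2
    simp only [hidx, sum_Iic_fin g]
    rw [← zpow_natCast_apply]
    constructor
    · intro hk
      obtain ⟨j, hj⟩ := V.exists_visitTime hk h1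
      have hjq : j < q + 1 := by
        have := (V.visitTime_strictMono x).le_iff_le.1 (hj.trans_le (h2.trans_eq hq.symm))
        omega
      refine ⟨⟨j, hjq⟩, ?_⟩
      rw [← hj, visitTime_eq_sum]
    · rintro ⟨j, rfl⟩
      rw [← visitTime_eq_sum]
      exact V.visitTime_mem hx _
  · intro j
    simp only [hidx, sum_Iio_fin g]
    rw [← zpow_natCast_apply, ← visitTime_eq_sum]
    rfl
  · intro j
    rw [V.notMem_Y_iff, n_index]
    rfl

/-- The matrix `(f_{a - b} (h ^ b y))` made from the coefficients `f_k` of `F`. -/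
noncomputable def orbitMatrix (V : Visits h S N) (F : (orbitBase h S).Total) (y : T) (n : ℕ) :
    Matrix (Fin n) (Fin n) ℂ :=
  Matrix.of fun a b => V.coef F ((a : ℕ) - (b : ℕ)) ((h ^ ((b : ℕ) + 1 : ℤ)) y)

/-- The point belonging to a column lies in the tower over the visit that starts its block. Rows of
other blocks fall outside this tower, where the coefficient is zero; rows of the same block
reproduce the value of `F` at the visit. -/
theorem isBlockDiag_orbitMatrix (V : Visits h S N) {y : T} {n q : ℕ}
    {idx : Fin q → Fin (orbitBase h S).l} {pts : ∀ j, (orbitBase h S).X (idx j)}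
    (hI : IsItinerary h S y n idx pts) (F : (orbitBase h S).Total) :
    IsBlockDiag (V.orbitMatrix F y n) (fun k => (orbitBase h S).n (idx k))
      (fun k => F (idx k) (pts k)) := by
  refine ⟨hI.sum_eq, ?_⟩
  ext a b
  set e := finSigmaFinEquiv.trans (finCongr hI.sum_eq) with he
  obtain ⟨⟨k, a⟩, rfl⟩ := e.surjective a
  obtain ⟨⟨k', b⟩, rfl⟩ := e.surjective b
  have hval : ∀ (k : Fin q) (a : Fin ((orbitBase h S).n (idx k))),
      ((e ⟨k, a⟩ : Fin n) : ℕ) = ∑ m ∈ Finset.Iio k, (orbitBase h S).n (idx m) + a := by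
    intro k a
    rw [← sum_castLE_eq_sum_Iio fun m => (orbitBase h S).n (idx m)]
    exact finSigmaFinEquiv_apply _
  rw [Matrix.reindex_apply, Matrix.submatrix_apply, e.symm_apply_apply, e.symm_apply_apply,
    orbitMatrix, Matrix.of_apply, hval, hval]
  have hpt : (h ^ (((∑ m ∈ Finset.Iio k', (orbitBase h S).n (idx m) + b : ℕ) : ℤ) + 1)) y =
      (h ^ ((b : ℤ) + 1)) (toT (pts k')) := by
    rw [toT, hI.pts_eq, ← zpow_natCast_apply, ← zpow_add_apply]
    congr 2
    push_cast
    ring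
  rw [hpt, V.coef_base F _ (hI.pts_notMem k') (by omega) (by omega)]
  rcases lt_trichotomy k k' with hk | rfl | hk
  · rw [Matrix.blockDiagonal'_apply_ne _ _ _ hk.ne, ent_of_not_left]
    have := sum_Iio_add_le (fun m => (orbitBase h S).n (idx m)) hk
    have := a.2
    omega
  · rw [Matrix.blockDiagonal'_apply_eq, ← ent_fin (F (idx k) (pts k) : Matrix _ _ ℂ) a b]
    congr 1
    push_cast
    ring
  · rw [Matrix.blockDiagonal'_apply_ne _ _ _ hk.ne', ent_of_not_left]
    have := sum_Iio_add_le (fun m => (orbitBase h S).n (idx m)) hk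
    have := b.2
    omega

/-- The first segment has the return time of `y` as its length, less than `n_i` since `y ∈ Y_i`. Any
later one is a proper part of the segment of length `n_i`. -/
theorem itinerary_index_lt (V : Visits h S N) {i : Fin (orbitBase h S).l}
    {y : (orbitBase h S).X i} (hy : y ∈ (orbitBase h S).Y i) {q : ℕ}
    {idx : Fin q → Fin (orbitBase h S).l} {pts : ∀ j, (orbitBase h S).X (idx j)}
    (hI : IsItinerary h S (toT y) ((orbitBase h S).n i) idx pts) (k : Fin q) : idx k < i := by
  rw [← V.n_lt_iff]
  have hsum : ∑ m ∈ Finset.Iio k, (orbitBase h S).n (idx m) + (orbitBase h S).n (idx k) ≤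
      (orbitBase h S).n i := by
    rw [← hI.sum_eq, add_comm, ← Finset.sum_insert (Finset.notMem_Iio_self)
      (f := fun m => (orbitBase h S).n (idx m))]
    exact Finset.sum_le_sum_of_subset (Finset.subset_univ _)
  rcases Nat.eq_zero_or_pos (∑ m ∈ Finset.Iio k, (orbitBase h S).n (idx m)) with h0 | h0
  · have h1 := hI.pts_eq k
    rw [h0, Function.iterate_zero, id] at h1
    have h2 := (V.notMem_Y_iff _).1 (hI.pts_notMem k)
    rw [toT, h1] at h2
    rw [← h2]
    exact (V.mem_Y_iff y).1 hy
  · omega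

end Visits

/-! ### The orbit matrices as homomorphisms -/

namespace Visits

variable {T : Type u} [MetricSpace T] {h : T ≃ₜ T} {S : Set T} {N : ℕ}

/-- The block decomposition depends only on the itinerary, so it is common to `F`, `G` and `F * G`.
-/
theorem orbitMatrix_mul (V : Visits h S N) {y : T} (hy : y ∈ S) {n : ℕ} (hn0 : 0 < n)
    (hn : (h ^ (n : ℤ)) y ∈ S) (F G : (orbitBase h S).Total) :
    V.orbitMatrix (F * G) y n = V.orbitMatrix F y n * V.orbitMatrix G y n := by
  obtain ⟨q, idx, pts, hI⟩ := V.exists_itinerary hy hn0 hn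
  obtain ⟨_, e1⟩ := V.isBlockDiag_orbitMatrix hI (F * G)
  obtain ⟨_, e2⟩ := V.isBlockDiag_orbitMatrix hI F
  obtain ⟨_, e3⟩ := V.isBlockDiag_orbitMatrix hI G
  rw [e1, e2, e3, Matrix.reindex_apply, Matrix.reindex_apply, Matrix.reindex_apply,
    Matrix.submatrix_mul_equiv, ← Matrix.blockDiagonal'_mul]
  rfl

theorem orbitMatrix_star (V : Visits h S N) {y : T} (hy : y ∈ S) {n : ℕ} (hn0 : 0 < n)
    (hn : (h ^ (n : ℤ)) y ∈ S) (F : (orbitBase h S).Total) :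
    V.orbitMatrix (star F) y n = star (V.orbitMatrix F y n) := by
  obtain ⟨q, idx, pts, hI⟩ := V.exists_itinerary hy hn0 hn
  obtain ⟨_, e1⟩ := V.isBlockDiag_orbitMatrix hI (star F)
  obtain ⟨_, e2⟩ := V.isBlockDiag_orbitMatrix hI F
  rw [e1, e2, Matrix.star_eq_conjTranspose, Matrix.reindex_apply, Matrix.reindex_apply,
    Matrix.conjTranspose_submatrix, Matrix.blockDiagonal'_conjTranspose]
  rfl

/-- `F ↦ V.orbitMatrix F y n`, for a segment of an orbit between two points of `S`. -/
noncomputable def orbitMatrixHom (V : Visits h S N) {y : T} (hy : y ∈ S) {n : ℕ} (hn0 : 0 < n)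
    (hn : (h ^ (n : ℤ)) y ∈ S) : (orbitBase h S).Total →⋆ₐ[ℂ] Matrix (Fin n) (Fin n) ℂ where
  toAlgHom := AlgHom.ofLinearMap
    { toFun := fun F => V.orbitMatrix F y n
      map_add' := fun F G => by ext; exact V.coef_add F G _ _
      map_smul' := fun c F => by ext; exact V.coef_smul c F _ _ }
    (by
      ext a b
      simp only [LinearMap.coe_mk, AddHom.coe_mk, orbitMatrix, Matrix.of_apply, V.coef_one,
        Matrix.one_apply, Fin.ext_iff, sub_eq_zero, Nat.cast_inj])
    (V.orbitMatrix_mul hy hn0 hn)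
  map_star' := V.orbitMatrix_star hy hn0 hn

/-- Since `y` and `h^(n_i) y` are visits, the return segment containing `h^b y` lies within the
orbit of `y` up to time `n_i`. It is shorter than `n_i`: either it starts at `y`, which returns
early, or it starts later. -/
theorem base_lt (V : Visits h S N) {i j : Fin (orbitBase h S).l} {y : (orbitBase h S).X i}
    (hy : y ∈ (orbitBase h S).Y i) {z : (orbitBase h S).X j} (hz : z ∉ (orbitBase h S).Y j)
    {b c : ℤ} (hb : b ≤ (orbitBase h S).n i) (hc1 : 1 ≤ c)
    (hc2 : c ≤ (orbitBase h S).n j) (hb1 : 1 ≤ b) (e : (h ^ b) (toT y) = (h ^ c) (toT z)) :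
    j < i := by
  rw [V.notMem_Y_iff] at hz
  rw [V.mem_Y_iff] at hy
  rw [← V.n_lt_iff]
  have e' : (h ^ (b - c)) (toT y) = toT z := by
    rw [sub_eq_neg_add, zpow_add_apply, e, ← zpow_add_apply, neg_add_cancel, zpow_zero_apply]
  have hcb : c ≤ b := by
    by_contra! hlt
    refine notMem_of_lt_returnTime (S := S) (h := h) (toT z) (c := c - b) (by omega) (by omega) ?_
    rw [← e', ← zpow_add_apply, show c - b + (b - c) = 0 by ring, zpow_zero_apply]
    exact (V.base_mem y).1
  rcases hcb.eq_or_lt with rfl | hlt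
  · rw [sub_self, zpow_zero_apply] at e'
    rwa [e', hz] at hy
  · have := returnTime_le (S := S) (h := h) (toT z) (c := (orbitBase h S).n i - (b - c))
      (by omega) (by
        rw [← e', ← zpow_add_apply, sub_add_cancel]
        exact (V.base_mem y).2)
    omega

theorem orbitMatrix_congr (V : Visits h S N) {i : Fin (orbitBase h S).l}
    {y : (orbitBase h S).X i} (hy : y ∈ (orbitBase h S).Y i) {F G : (orbitBase h S).Total}
    (hFG : ∀ j, j < i → F j = G j) :
    V.orbitMatrix F (toT y) ((orbitBase h S).n i) =
      V.orbitMatrix G (toT y) ((orbitBase h S).n i) := by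
  ext a b
  rw [orbitMatrix, orbitMatrix, Matrix.of_apply, Matrix.of_apply]
  obtain ⟨j, z, c, hz, h1, h2, e⟩ := V.exists_base ((h ^ ((b : ℕ) + 1 : ℤ)) (toT y))
  rw [e, V.coef_base F _ hz h1 h2, V.coef_base G _ hz h1 h2,
    hFG j (V.base_lt hy hz (by omega) h1 h2 (by omega) e)]

/-- `F` agrees at the points of `Y_j` with the matrices of its coefficients. -/
def Compat (V : Visits h S N) (F : (orbitBase h S).Total) (j : Fin (orbitBase h S).l) : Prop :=
  ∀ y : (orbitBase h S).Y j, V.orbitMatrix F (toT y.1) ((orbitBase h S).n j) = F j y.1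

/-- Compatibility extends `coef_base` across `Y_j`, giving one continuous formula on all of `X_j`.
-/
theorem Compat.coef_point {V : Visits h S N} {F : (orbitBase h S).Total}
    {j : Fin (orbitBase h S).l} (hF : V.Compat F j) (k : ℤ) (x : (orbitBase h S).X j) {c : ℤ}
    (h1 : 1 ≤ c) (h2 : c ≤ (orbitBase h S).n j) :
    V.coef F k ((h ^ c) (toT x)) = ent (F j x) (c + k) c := by
  by_cases hx : x ∈ (orbitBase h S).Y j
  swap
  · exact V.coef_base F k hx h1 h2
  by_cases hr : 1 ≤ c + k ∧ c + k ≤ (orbitBase h S).n j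
  · obtain ⟨a, ha⟩ := exists_fin_eq hr
    obtain ⟨b, rfl⟩ := exists_fin_eq ⟨h1, h2⟩
    rw [ha, ← hF ⟨x, hx⟩, ent_fin, orbitMatrix, Matrix.of_apply,
      show k = (a : ℕ) - (b : ℕ) by omega]
  -- Leaving the range `1, …, n_j` passes `x` or `h^(n_j) x`, which lie in `S` even for `x ∈ Y_j`.
  · rw [ent_of_not_left _ hr]
    refine V.coef_eq_zero F ?_
    obtain ⟨hx1, hx2⟩ := V.base_mem x
    by_cases h3 : c + k < 1
    · refine ⟨-c, by omega, by omega, ?_⟩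
      rwa [← zpow_add_apply, neg_add_cancel, zpow_zero_apply]
    · refine ⟨(orbitBase h S).n j - c, by omega, by omega, ?_⟩
      rwa [← zpow_add_apply, sub_add_cancel]

/-- The set is a finite union of closed pieces `h^c(X_j)`, and on each the coefficient is an entry
of `F j` composed with `h^(-c)`. The bound `m` allows use at an intermediate stage, when only the
earlier indices are compatible. -/
theorem continuousOn_coef (V : Visits h S N) {F : (orbitBase h S).Total} {m : ℕ}
    (hF : ∀ j : Fin (orbitBase h S).l, j.1 < m → V.Compat F j) (k : ℤ) :
    ContinuousOn (V.coef F k) {t | ∃ j : Fin (orbitBase h S).l, j.1 < m ∧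
      ∃ (x : (orbitBase h S).X j) (b : Fin ((orbitBase h S).n j)),
        (h ^ ((b : ℕ) + 1 : ℤ)) (toT x) = t} := by
  let ι := Σ j : {j : Fin (orbitBase h S).l // j.1 < m}, Fin ((orbitBase h S).n j.1)
  let A : ι → Set T := fun p => (h ^ ((p.2 : ℕ) + 1 : ℤ)) ''
    closure (returnLevel h S ((orbitBase h S).n p.1.1))
  have hA : {t | ∃ j : Fin (orbitBase h S).l, j.1 < m ∧
      ∃ (x : (orbitBase h S).X j) (b : Fin ((orbitBase h S).n j)),
        (h ^ ((b : ℕ) + 1 : ℤ)) (toT x) = t} = ⋃ p, A p := by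
    ext t
    rw [Set.mem_iUnion]
    constructor
    · rintro ⟨j, hj, x, b, rfl⟩
      exact ⟨⟨⟨j, hj⟩, b⟩, toT x, x.2, rfl⟩
    · rintro ⟨⟨⟨j, hj⟩, b⟩, x, hx, rfl⟩
      exact ⟨j, hj, ⟨x, hx⟩, b, rfl⟩
  rw [hA]
  refine (locallyFinite_of_finite A).continuousOn_iUnion
    (fun p => (h ^ ((p.2 : ℕ) + 1 : ℤ)).isClosed_image.2 isClosed_closure) ?_
  rintro ⟨⟨j, hj⟩, b⟩
  set c : ℤ := (b : ℕ) + 1 with hc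
  have hcn : c ≤ (orbitBase h S).n j := by
    have : (b : ℕ) < (orbitBase h S).n j := b.2
    omega
  have hmem : ∀ t : A ⟨⟨j, hj⟩, b⟩, (h ^ (-c)) t ∈
      closure (returnLevel h S ((orbitBase h S).n j)) := by
    rintro ⟨_, x, hx, rfl⟩
    dsimp only
    rwa [← zpow_add_apply, neg_add_cancel, zpow_zero_apply]
  rw [continuousOn_iff_continuous_domRestrict]
  let g : A ⟨⟨j, hj⟩, b⟩ → (orbitBase h S).X j := fun t => ⟨_, hmem t⟩
  have hg : Continuous g :=
    ((h ^ (-c)).continuous.comp continuous_subtype_val).subtype_mk _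
  have : (A ⟨⟨j, hj⟩, b⟩).domRestrict (V.coef F k) = fun t => ent (F j (g t)) (c + k) c := by
    funext t
    rw [← (hF j hj).coef_point k (g t) (by omega) hcn]
    show _ = V.coef F k ((h ^ c) ((h ^ (-c)) (t : T)))
    rw [← zpow_add_apply, add_neg_cancel, zpow_zero_apply]
    rfl
  rw [this]
  exact (continuous_ent _ _).comp ((F j).continuous.comp hg)

end Visits

/-! ### The decomposition -/

namespace RSHBase

/-- Extension by zero of a tuple over the indices below `i`. -/
noncomputable def extend (B : RSHBase.{u}) (i : Fin B.l) (f : B.Below i) : B.Total :=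
  fun j => if hj : j < i then f ⟨j, hj⟩ else 0

theorem extend_of_lt {B : RSHBase.{u}} {i j : Fin B.l} (f : B.Below i) (hj : j < i) :
    B.extend i f j = f ⟨j, hj⟩ := dif_pos hj

end RSHBase

namespace Visits

variable {T : Type u} [MetricSpace T] {h : T ≃ₜ T} {S : Set T} {N : ℕ}

/-- The homomorphism that attaches the fibre over a point of `Y_i`. -/
noncomputable def attach (V : Visits h S N) {i : Fin (orbitBase h S).l} (y : (orbitBase h S).Y i) :
    (orbitBase h S).Below i →⋆ₐ[ℂ]
      Matrix (Fin ((orbitBase h S).n i)) (Fin ((orbitBase h S).n i)) ℂ :=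
  -- The orbit matrix over `Y_i` sees only indices below `i`, and truncation is a surjective
  -- homomorphism, so the algebraic laws descend from `orbitMatrixHom`.
  have key : ∀ F : (orbitBase h S).Total,
      V.orbitMatrix ((orbitBase h S).extend i ((orbitBase h S).truncTotal i F)) (toT y.1)
        ((orbitBase h S).n i) =
      V.orbitMatrixHom (V.base_mem y.1).1 (V.n_pos i) (V.base_mem y.1).2 F := fun F =>
    V.orbitMatrix_congr y.2 fun j hj => RSHBase.extend_of_lt _ hj
  have surj : ∀ f : (orbitBase h S).Below i, ∃ F : (orbitBase h S).Total,
      (orbitBase h S).truncTotal i F = f := fun f =>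
    ⟨(orbitBase h S).extend i f, funext fun j => RSHBase.extend_of_lt f j.2⟩
  { toFun := fun f => V.orbitMatrix ((orbitBase h S).extend i f) (toT y.1) ((orbitBase h S).n i)
    map_one' := (key 1).trans (map_one _)
    map_zero' := (key 0).trans (map_zero _)
    commutes' := fun c => (key (algebraMap ℂ _ c)).trans (AlgHomClass.commutes _ c)
    map_mul' := fun f g => by
      obtain ⟨F, rfl⟩ := surj f
      obtain ⟨G, rfl⟩ := surj g
      exact (key (F * G)).trans ((map_mul _ F G).trans (by rw [key F, key G]))
    map_add' := fun f g => by
      obtain ⟨F, rfl⟩ := surj f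
      obtain ⟨G, rfl⟩ := surj g
      exact (key (F + G)).trans ((map_add _ F G).trans (by rw [key F, key G]))
    map_star' := fun f => by
      obtain ⟨F, rfl⟩ := surj f
      exact (key (star F)).trans ((map_star _ F).trans (by rw [key F])) }

theorem attach_trunc (V : Visits h S N) {i : Fin (orbitBase h S).l} (y : (orbitBase h S).Y i)
    {f : (orbitBase h S).Below i} {F : (orbitBase h S).Total}
    (hF : ∀ (j : Fin (orbitBase h S).l) (hj : j < i), F j = f ⟨j, hj⟩) : V.attach y f =
      V.orbitMatrix F (toT y.1) ((orbitBase h S).n i) :=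
  V.orbitMatrix_congr y.2 fun j hj => (RSHBase.extend_of_lt _ hj).trans (hF j hj).symm

/-- The tuples below `i` that are compatible at all the sets `Y_j`. -/
noncomputable def stage (V : Visits h S N) (i : Fin (orbitBase h S).l) :
    StarSubalgebra ℂ ((orbitBase h S).Below i) where
  carrier := {f | ∀ (j : Fin (orbitBase h S).l) (hj : j < i) (y : (orbitBase h S).Y j),
    V.attach y ((orbitBase h S).truncBelow hj f) = f ⟨j, hj⟩ y.1}
  mul_mem' hf hg j hj y :=
    (map_mul (V.attach y) _ _).trans (congrArg₂ (· * ·) (hf j hj y) (hg j hj y))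
  add_mem' hf hg j hj y :=
    (map_add (V.attach y) _ _).trans (congrArg₂ (· + ·) (hf j hj y) (hg j hj y))
  algebraMap_mem' c _ _ y := AlgHomClass.commutes (V.attach y) c
  star_mem' hf j hj y :=
    (map_star (V.attach y) _).trans (congrArg star (hf j hj y))

theorem compat_extend (V : Visits h S N) {i : Fin (orbitBase h S).l}
    {f : (orbitBase h S).Below i} (hf : f ∈ V.stage i) {j : Fin (orbitBase h S).l} (hj : j < i) :
    V.Compat ((orbitBase h S).extend i f) j := fun y => by
  rw [RSHBase.extend_of_lt f hj, ← hf j hj y]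
  exact (V.attach_trunc y fun k hk => RSHBase.extend_of_lt f (hk.trans hj)).symm

/-- By `base_lt` the points `h^(b+1) y` lie in towers over earlier indices, where membership in the
stage already gives continuous coefficients. -/
theorem continuous_attach (V : Visits h S N) {i : Fin (orbitBase h S).l}
    {f : (orbitBase h S).Below i} (hf : f ∈ V.stage i) :
    Continuous fun y : (orbitBase h S).Y i => V.attach y f := by
  refine continuous_matrix fun a b => ?_
  refine (V.continuousOn_coef (m := i.1) (fun j hj => V.compat_extend hf hj)
    ((a : ℕ) - (b : ℕ))).comp_continuous ((h ^ ((b : ℕ) + 1 : ℤ)).continuous.comp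
      (continuous_toT.comp continuous_subtype_val)) fun y => ?_
  obtain ⟨j, z, c, hz, h1, h2, e⟩ := V.exists_base ((h ^ ((b : ℕ) + 1 : ℤ)) (toT y.1))
  obtain ⟨c, rfl⟩ := exists_fin_eq ⟨h1, h2⟩
  exact ⟨j, V.base_lt y.2 hz (by omega) h1 h2 (by omega) e, z, c, e.symm⟩

/-- The decomposition of the orbit-breaking algebra of `S`. -/
noncomputable def decomp (V : Visits h S N) [CompactSpace T] (hne : S.Nonempty) :
    RSHDecomp (orbitBase h S) where
  length_pos := (V.index ⟨_, hne.some_mem⟩).pos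
  size_pos := V.n_pos
  compact_X i := isCompact_iff_compactSpace.1
    (isClosed_closure (s := returnLevel h S ((orbitBase h S).n i))).isCompact
  closed_Y := V.isClosed_Y
  Y_first := V.Y_first
  stage := V.stage
  φ _ :=
    { toFun := fun f => ⟨fun y => V.attach y f.1, V.continuous_attach f.2⟩
      map_one' := ContinuousMap.ext fun y => map_one (V.attach y)
      map_zero' := ContinuousMap.ext fun y => map_zero (V.attach y)
      commutes' := fun c => ContinuousMap.ext fun y => AlgHomClass.commutes (V.attach y) c
      map_mul' := fun f g => ContinuousMap.ext fun y => map_mul (V.attach y) f.1 g.1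
      map_add' := fun f g => ContinuousMap.ext fun y => map_add (V.attach y) f.1 g.1
      map_star' := fun f => ContinuousMap.ext fun y => map_star (V.attach y) f.1 }
  mem_stage _ _ :=
    ⟨fun hf j hj => ⟨fun k hk y => hf k (hk.trans hj) y, fun y => hf j hj y⟩,
      fun hf j hj y => (hf j hj).2 y⟩

variable [CompactSpace T]

theorem mem_algebra_iff (V : Visits h S N) (hne : S.Nonempty) (F : (orbitBase h S).Total) :
    F ∈ (V.decomp hne).algebra ↔ ∀ i, V.Compat F i := by
  have key : ∀ (i : Fin (orbitBase h S).l) (y : (orbitBase h S).Y i),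
      V.attach y ((orbitBase h S).truncTotal i F) =
        V.orbitMatrix F (toT y.1) ((orbitBase h S).n i) := fun i y =>
    V.attach_trunc y fun _ _ => rfl
  constructor
  · intro hF i y
    obtain ⟨_, e⟩ := hF i
    exact (key i y).symm.trans (e y)
  · intro hF i
    exact ⟨fun j hj y => (key j y).trans (hF j y), fun y => (key i y).trans (hF i y)⟩

theorem isOrbitDecomp (V : Visits h S N) (hne : S.Nonempty) :
    IsOrbitDecomp h S (V.decomp hne) := by
  intro i y
  obtain ⟨q, idx, pts, hI⟩ := V.exists_itinerary (V.base_mem y.1).1 (V.n_pos i) (V.base_mem y.1).2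
  have hlt := V.itinerary_index_lt y.2 hI
  refine ⟨q, idx, pts, hI, hlt, hI.pts_notMem, fun f => ?_⟩
  have := V.isBlockDiag_orbitMatrix hI ((orbitBase h S).extend i f.1)
  simp only [RSHBase.extend_of_lt f.1 (hlt _)] at this
  exact this

theorem isDSH (V : Visits h S N) (hne : S.Nonempty) : (V.decomp hne).IsDSH := fun i y => by
  obtain ⟨q, idx, pts, _, hD⟩ := V.isOrbitDecomp hne i y
  exact ⟨q, idx, pts, hD⟩

end Visits

/-! ### Representations on `ℓ²(ℤ)` given by orbits -/

section OrbitRep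

variable {T : Type u} [TopologicalSpace T] [CompactSpace T]

theorem memℓp_mul_apply (f : C(T, ℂ)) (s : ℤ → T) (ξ : HilbertZ) :
    Memℓp (fun k => f (s k) * ξ k) 2 := by
  refine Memℓp.mono' (F := fun _ => ℂ) (lp.memℓp ((‖f‖ : ℂ) • ξ)) fun k => ?_
  rw [lp.coeFn_smul, Pi.smul_apply, norm_smul, norm_mul, Complex.norm_real, norm_norm]
  exact mul_le_mul_of_nonneg_right (f.norm_coe_le_norm _) (norm_nonneg _)

/-- The operator of multiplication by the values of `f` at the points `s k`. -/
noncomputable def diagOp (s : ℤ → T) (f : C(T, ℂ)) : HilbertZ →L[ℂ] HilbertZ :=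
  LinearMap.mkContinuous
    { toFun := fun ξ => ⟨fun k => f (s k) * ξ k, memℓp_mul_apply f s ξ⟩
      map_add' := fun ξ η => lp.ext (funext fun k => mul_add (f (s k)) (ξ k) (η k))
      map_smul' := fun c ξ => lp.ext (funext fun k => mul_left_comm (f (s k)) c (ξ k)) }
    ‖f‖ (fun ξ => by
      have e : ‖f‖ * ‖ξ‖ = ‖(‖f‖ : ℂ) • ξ‖ := by
        rw [norm_smul, Complex.norm_real, norm_norm]
      rw [e]
      refine lp.norm_mono (by norm_num) fun k => ?_
      rw [lp.coeFn_smul, Pi.smul_apply, norm_smul, Complex.norm_real, norm_norm]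
      exact (norm_mul _ _).trans_le
        (mul_le_mul_of_nonneg_right (f.norm_coe_le_norm _) (norm_nonneg _)))

theorem diagOp_apply (s : ℤ → T) (f : C(T, ℂ)) (ξ : HilbertZ) (k : ℤ) :
    diagOp s f ξ k = f (s k) * ξ k := rfl

/-- The representation of `C(T)` by diagonal operators. -/
noncomputable def diagRep (s : ℤ → T) : C(T, ℂ) →⋆ₐ[ℂ] (HilbertZ →L[ℂ] HilbertZ) where
  toFun := diagOp s
  map_one' := by ext ξ k; simp [diagOp_apply]
  map_mul' f g := by ext ξ k; simp [diagOp_apply, mul_assoc]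
  map_zero' := by ext ξ k; simp [diagOp_apply]
  map_add' f g := by ext ξ k; simp [diagOp_apply, add_mul]
  commutes' c := by ext ξ k; simp [diagOp_apply, Algebra.algebraMap_eq_smul_one]
  map_star' f := by
    rw [ContinuousLinearMap.star_eq_adjoint, ContinuousLinearMap.eq_adjoint_iff]
    intro ξ η
    rw [lp.inner_eq_tsum, lp.inner_eq_tsum]
    refine tsum_congr fun k => ?_
    simp only [diagOp_apply, ContinuousMap.star_apply, RCLike.inner_apply, map_mul,
      RCLike.star_def, Complex.conj_conj]
    ring

/-- The bilateral shift of `ℓ²(ℤ)`. -/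
noncomputable def shiftIso : HilbertZ ≃ₗᵢ[ℂ] HilbertZ :=
  have hm : ∀ (e : ℤ ≃ ℤ) (ξ : HilbertZ), Memℓp (fun k => ξ (e k)) 2 := fun e ξ => by
    rw [memℓp_gen_iff (by norm_num)]
    exact (e.summable_iff (f := fun k => ‖ξ k‖ ^ (2 : ℝ≥0∞).toReal)).2
      ((lp.memℓp ξ).summable (by norm_num))
  { toFun := fun ξ => ⟨fun k => ξ (k - 1), hm (Equiv.subRight 1) ξ⟩
    invFun := fun ξ => ⟨fun k => ξ (k + 1), hm (Equiv.addRight 1) ξ⟩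
    map_add' := fun ξ η => rfl
    map_smul' := fun c ξ => rfl
    left_inv := fun ξ => lp.ext (funext fun k => congrArg ξ (add_sub_cancel_right k 1))
    right_inv := fun ξ => lp.ext (funext fun k => congrArg ξ (sub_add_cancel k 1))
    norm_map' := fun ξ => by
      rw [lp.norm_eq_tsum_rpow (by norm_num), lp.norm_eq_tsum_rpow (by norm_num)]
      congr 1
      exact (Equiv.subRight (1 : ℤ)).tsum_eq (fun k => ‖ξ k‖ ^ (2 : ℝ≥0∞).toReal) }

/-- The covariant representation given by the orbit of `x`. -/
noncomputable def orbitRep (h : T ≃ₜ T) (x : T) : CovariantRep h where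
  π := diagRep fun k => (h ^ k) x
  v := Unitary.linearIsometryEquiv.symm shiftIso
  covariant f := by
    set v := Unitary.linearIsometryEquiv.symm shiftIso
    have key : (v : HilbertZ →L[ℂ] HilbertZ) * diagRep (fun k => (h ^ k) x) f =
        diagRep (fun k => (h ^ k) x) (shift h f) * (v : HilbertZ →L[ℂ] HilbertZ) := by
      ext ξ k
      show f ((h ^ (k - 1)) x) * ξ (k - 1) = f (h.symm ((h ^ k) x)) * ξ (k - 1)
      rw [sub_eq_neg_add, zpow_add_apply, zpow_neg_one]
      rfl
    rw [key, mul_assoc, Unitary.mul_star_self_of_mem v.2, mul_one]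

theorem orbitRep_zpow_apply (h : T ≃ₜ T) (x : T) (j : ℤ) (ξ : HilbertZ) (k : ℤ) :
    (((orbitRep h x).v ^ j : unitary (HilbertZ →L[ℂ] HilbertZ)) : HilbertZ →L[ℂ] HilbertZ) ξ k =
      ξ (k - j) := by
  induction j generalizing ξ k with
  | zero => simp
  | succ j ih =>
    rw [zpow_add_one]
    refine (ih _ k).trans ?_
    exact congrArg ξ (show k - j - 1 = _ by ring)
  | pred j ih =>
    rw [zpow_sub_one]
    refine (ih _ k).trans ?_
    set η := (((orbitRep h x).v⁻¹ : unitary (HilbertZ →L[ℂ] HilbertZ)) :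
      HilbertZ →L[ℂ] HilbertZ) ξ with hη
    have e : ((orbitRep h x).v : HilbertZ →L[ℂ] HilbertZ) η = ξ :=
      congrArg (fun w : unitary (HilbertZ →L[ℂ] HilbertZ) => (w : HilbertZ →L[ℂ] HilbertZ) ξ)
        (mul_inv_cancel (orbitRep h x).v)
    exact (congrArg η (show k - -(j : ℤ) = k - (-j - 1) - 1 by ring)).trans
      (congrArg (fun w : HilbertZ => w (k - (-j - 1))) e)

end OrbitRep

/-! ### Computations in the crossed product -/

section Crossed

variable {T : Type u} [MetricSpace T] (h : T ≃ₜ T)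

/-- Evaluation of a bounded family of operators at a covariant representation. -/
noncomputable def evalRep (p : CovariantRep h) :
    CovariantFamilies h →⋆ₐ[ℂ] (HilbertZ →L[ℂ] HilbertZ) where
  toFun a := a.1 p
  map_one' := rfl
  map_mul' _ _ := rfl
  map_zero' := rfl
  map_add' _ _ := rfl
  commutes' _ := rfl
  map_star' _ := rfl

theorem norm_evalRep_le (p : CovariantRep h) (a : CovariantFamilies h) :
    ‖evalRep h p a‖ ≤ ‖a‖ := lp.norm_apply_le_norm ENNReal.top_ne_zero _ p

variable {h} in
theorem CovariantFamilies.ext_evalRep {a b : CovariantFamilies h}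
    (H : ∀ p, evalRep h p a = evalRep h p b) : a = b := lp.ext (funext H)

theorem evalRep_universalUnitary (p : CovariantRep h) :
    evalRep h p (universalUnitary h) = p.v := rfl

/-- The function `f ∘ h ^ k`. -/
noncomputable def twist (k : ℤ) (f : C(T, ℂ)) : C(T, ℂ) := f.comp ((h ^ k : T ≃ₜ T) : C(T, T))

theorem twist_apply (k : ℤ) (f : C(T, ℂ)) (t : T) : twist h k f t = f ((h ^ k) t) := rfl

theorem twist_add (k l : ℤ) (f : C(T, ℂ)) : twist h (k + l) f = twist h l (twist h k f) := by
  ext t; simp only [twist_apply, zpow_add_apply]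

variable [CompactSpace T]

/-- The canonical embedding of `C(T)` in the crossed product, as a homomorphism. -/
noncomputable def crossedHom : C(T, ℂ) →⋆ₐ[ℂ] crossedProduct h where
  toFun := crossedι h
  map_one' := Subtype.ext (map_one (universalRep h))
  map_mul' f g := Subtype.ext (map_mul (universalRep h) f g)
  map_zero' := Subtype.ext (map_zero (universalRep h))
  map_add' f g := Subtype.ext (map_add (universalRep h) f g)
  commutes' c := Subtype.ext (AlgHomClass.commutes (universalRep h) c)
  map_star' f := Subtype.ext (map_star (universalRep h) f)

theorem evalRep_universalRep (p : CovariantRep h) (f : C(T, ℂ)) :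
    evalRep h p (universalRep h f) = p.π f := rfl

/-- The canonical unitary of the crossed product. -/
noncomputable def crossedUnitary : unitary (crossedProduct h) :=
  ⟨crossedU h, Unitary.mem_iff.2
    ⟨Subtype.ext (CovariantFamilies.ext_evalRep fun p => by
        show evalRep h p (star (universalUnitary h) * universalUnitary h) = evalRep h p 1
        rw [map_mul, map_star, map_one, evalRep_universalUnitary,
          Unitary.star_mul_self_of_mem p.v.2]),
      Subtype.ext (CovariantFamilies.ext_evalRep fun p => by
        show evalRep h p (universalUnitary h * star (universalUnitary h)) = evalRep h p 1
        rw [map_mul, map_star, map_one, evalRep_universalUnitary,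
          Unitary.mul_star_self_of_mem p.v.2])⟩⟩

/-- The powers of the canonical unitary. -/
noncomputable def uPow (k : ℤ) : crossedProduct h :=
  ((crossedUnitary h ^ k : unitary (crossedProduct h)) : crossedProduct h)

theorem uPow_add (k l : ℤ) : uPow h (k + l) = uPow h k * uPow h l := by
  rw [uPow, zpow_add]; rfl

theorem uPow_zero : uPow h 0 = 1 := by
  rw [uPow, zpow_zero]; rfl

theorem uPow_one : uPow h 1 = crossedU h := by
  rw [uPow, zpow_one]; rfl

theorem star_uPow (k : ℤ) : star (uPow h k) = uPow h (-k) := by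
  rw [uPow, uPow, zpow_neg]; rfl

theorem covariance (f : C(T, ℂ)) :
    crossedU h * crossedHom h f * star (crossedU h) = crossedHom h (shift h f) :=
  Subtype.ext (CovariantFamilies.ext_evalRep fun p => by
    show evalRep h p (universalUnitary h * universalRep h f * star (universalUnitary h)) =
      evalRep h p (universalRep h (shift h f))
    rw [map_mul, map_mul, map_star, evalRep_universalUnitary, evalRep_universalRep,
      evalRep_universalRep, p.covariant])

theorem crossedHom_mul_uPow (f : C(T, ℂ)) (k : ℤ) :
    crossedHom h f * uPow h k = uPow h k * crossedHom h (twist h k f) := by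
  have h0 : star (crossedU h) * crossedU h = 1 := (Unitary.mem_iff.1 (crossedUnitary h).2).1
  have h1 : ∀ f, crossedHom h f * uPow h 1 = uPow h 1 * crossedHom h (twist h 1 f) := by
    intro f
    have := covariance h (twist h 1 f)
    have e : shift h (twist h 1 f) = f := by
      ext t
      show f ((h ^ (1 : ℤ)) (h.symm t)) = f t
      rw [zpow_one, h.apply_symm_apply]
    rw [e] at this
    rw [uPow_one, ← this, mul_assoc, h0, mul_one]
  have h2 : ∀ f, crossedHom h f * uPow h (-1) = uPow h (-1) * crossedHom h (twist h (-1) f) := by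
    intro f
    have := covariance h f
    have e : shift h f = twist h (-1) f := by
      ext t
      rw [twist_apply, zpow_neg_one]
      rfl
    rw [← e, ← this, ← star_uPow, uPow_one, ← mul_assoc, ← mul_assoc, h0, one_mul]
  induction k generalizing f with
  | zero =>
    have : twist h 0 f = f := by ext t; rw [twist_apply, zpow_zero_apply]
    rw [uPow_zero, this, one_mul, mul_one]
  | succ k ih =>
    rw [uPow_add, ← mul_assoc, ih, mul_assoc, h1, ← mul_assoc, twist_add]
  | pred k ih =>
    rw [sub_eq_add_neg, uPow_add, ← mul_assoc, ih, mul_assoc, h2, ← mul_assoc, twist_add]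

/-- The element `∑ u ^ k c_k`, with `|k| < N`, of the crossed product. -/
noncomputable def polySum (N : ℕ) (c : ℤ → C(T, ℂ)) : crossedProduct h :=
  ∑ k ∈ Finset.Ioo (-N : ℤ) N, uPow h k * crossedHom h (c k)

theorem evalRep_uPow_mul (x : T) (j : ℤ) (f : C(T, ℂ)) (ξ : HilbertZ) (k : ℤ) :
    evalRep h (orbitRep h x) (uPow h j * crossedHom h f : crossedProduct h).1 ξ k =
      f ((h ^ (k - j)) x) * ξ (k - j) := by
  have hu : evalRep h (orbitRep h x) (uPow h j).1 =
      (((orbitRep h x).v ^ j : unitary (HilbertZ →L[ℂ] HilbertZ)) : HilbertZ →L[ℂ] HilbertZ) := by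
    let φ : crossedProduct h →⋆ₐ[ℂ] (HilbertZ →L[ℂ] HilbertZ) :=
      (evalRep h (orbitRep h x)).comp (crossedProduct h).subtype
    let ψ : crossedProduct h →⋆* (HilbertZ →L[ℂ] HilbertZ) :=
      { toFun := φ, map_one' := map_one φ, map_mul' := map_mul φ, map_star' := map_star φ }
    have := map_zpow (Unitary.map ψ) (crossedUnitary h) j
    exact congrArg Subtype.val this
  have := orbitRep_zpow_apply h x j (diagOp (fun k => (h ^ k) x) f ξ) k
  rw [← hu] at this
  exact this

/-- In the representation on the orbit of `x`, the entry in row `k` and column `0` of the sum is `c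
k x`, since `u^j` moves position `0` to position `j`. -/
theorem norm_le_norm_polySum (N : ℕ) (c : ℤ → C(T, ℂ)) {k : ℤ} (hk : k ∈ Finset.Ioo (-N : ℤ) N) :
    ‖c k‖ ≤ ‖polySum h N c‖ := by
  refine (ContinuousMap.norm_le _ (norm_nonneg _)).2 fun x => ?_
  let δ : HilbertZ := lp.single 2 (0 : ℤ) (1 : ℂ)
  have hδ : ‖δ‖ = 1 := by
    rw [lp.norm_single (by norm_num), norm_one]
  have hval : evalRep h (orbitRep h x) (polySum h N c).1 δ k = c k x := by
    have e : evalRep h (orbitRep h x) (polySum h N c).1 δ k =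
        ∑ j ∈ Finset.Ioo (-N : ℤ) N, c j ((h ^ (k - j)) x) * δ (k - j) := by
      simp only [← evalRep_uPow_mul]
      rw [polySum, AddSubmonoidClass.coe_finsetSum, map_sum, sum_apply,
        lp.coeFn_sum, Finset.sum_apply]
    rw [e, Finset.sum_eq_single k]
    · rw [sub_self, zpow_zero_apply]
      simp [δ]
    · intro j _ hj
      have : δ (k - j) = 0 := lp.single_apply_ne _ _ _ (by omega)
      rw [this, mul_zero]
    · exact fun hk' => absurd hk hk'
  rw [← hval]
  calc _ ≤ ‖evalRep h (orbitRep h x) (polySum h N c).1 δ‖ :=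
        lp.norm_apply_le_norm (by norm_num) _ k
    _ ≤ ‖evalRep h (orbitRep h x) (polySum h N c).1‖ * ‖δ‖ :=
        ContinuousLinearMap.le_opNorm _ _
    _ ≤ ‖polySum h N c‖ := by
        rw [hδ, mul_one]
        exact norm_evalRep_le h _ _

end Crossed

/-! ### The algebra of coefficient families -/

/-- The functions `c k` vanish where the orbit segment from `t` to `h ^ k t` crosses `S`. -/
def IsCoefFamily {T : Type u} [TopologicalSpace T] (h : T ≃ₜ T) (S : Set T)
    (c : ℤ → C(T, ℂ)) : Prop :=
  ∀ k t, Crosses h S k t → c k t = 0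

theorem Crosses.of_add {T : Type u} [TopologicalSpace T] {h : T ≃ₜ T} {S : Set T} {k l : ℤ}
    {t : T} (H : Crosses h S (k + l) t) : Crosses h S l t ∨ Crosses h S k ((h ^ l) t) := by
  obtain ⟨j, h1, h2, h3⟩ := H
  by_cases hj : min 0 l ≤ j ∧ j < max 0 l
  · exact Or.inl ⟨j, hj.1, hj.2, h3⟩
  · refine Or.inr ⟨j - l, by omega, by omega, ?_⟩
    rwa [← zpow_add_apply, sub_add_cancel]

section polySum

variable {T : Type u} [MetricSpace T] [CompactSpace T] {h : T ≃ₜ T} {S : Set T} {N : ℕ}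

theorem polySum_mul (V : Visits h S N) {c d : ℤ → C(T, ℂ)} (hc : IsCoefFamily h S c)
    (hd : IsCoefFamily h S d) : polySum h N c * polySum h N d =
      polySum h N fun m => ∑ l ∈ Finset.Ioo (-N : ℤ) N, twist h l (c (m - l)) * d l := by
  have h1 : polySum h N c * polySum h N d = ∑ l ∈ Finset.Ioo (-N : ℤ) N,
      ∑ k ∈ Finset.Ioo (-N : ℤ) N, uPow h (k + l) * crossedHom h (twist h l (c k) * d l) := by
    rw [polySum, polySum, Finset.sum_mul_sum, Finset.sum_comm]
    refine Finset.sum_congr rfl fun l _ => Finset.sum_congr rfl fun k _ => ?_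
    rw [mul_assoc, ← mul_assoc (crossedHom h (c k)), crossedHom_mul_uPow, uPow_add, map_mul]
    simp only [mul_assoc]
  have h2 : polySum h N (fun m => ∑ l ∈ Finset.Ioo (-N : ℤ) N, twist h l (c (m - l)) * d l) =
      ∑ l ∈ Finset.Ioo (-N : ℤ) N, ∑ m ∈ Finset.Ioo (-N : ℤ) N,
        uPow h m * crossedHom h (twist h l (c (m - l)) * d l) := by
    rw [polySum, Finset.sum_comm]
    refine Finset.sum_congr rfl fun m _ => ?_
    rw [map_sum, Finset.mul_sum]
  have mem : ∀ k : ℤ, ¬ (N : ℤ) ≤ |k| → k ∈ Finset.Ioo (-N : ℤ) N := fun k hk => by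
    rw [not_le, abs_lt] at hk
    exact Finset.mem_Ioo.2 hk
  rw [h1, h2]
  refine Finset.sum_congr rfl fun l _ => ?_
  refine Finset.sum_bij_ne_zero (fun k _ _ => k + l) ?_ ?_ ?_ ?_
  · intro k _ hne
    -- For `|k + l| ≥ N` the segment from `t` to `h^(k+l) t` crosses `S`, hence one of its two parts
    -- does and the product of coefficients vanishes. No power of `u` beyond the range survives.
    refine mem _ fun hN => hne ?_
    have : twist h l (c k) * d l = 0 := by
      ext t
      rcases (V.crosses_of_le hN t).of_add with ht | ht
      · exact mul_eq_zero_of_right _ (hd l t ht)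
      · exact mul_eq_zero_of_left (hc k _ ht) _
    rw [this, map_zero, mul_zero]
  · intro k _ _ k' _ _ e
    exact add_right_cancel e
  · intro m hm hne
    refine ⟨m - l, mem _ fun hN => hne ?_, ?_, sub_add_cancel m l⟩
    · have : twist h l (c (m - l)) * d l = 0 := by
        ext t
        exact mul_eq_zero_of_left (hc _ _ (V.crosses_of_le hN _)) _
      rw [this, map_zero, mul_zero]
    · rwa [sub_add_cancel]
  · intro k _ _
    rw [add_sub_cancel_right]

theorem polySum_star (h : T ≃ₜ T) (N : ℕ) (c : ℤ → C(T, ℂ)) :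
    star (polySum h N c) = polySum h N fun k => twist h k (star (c (-k))) := by
  rw [polySum, polySum, star_sum]
  refine Finset.sum_equiv (Equiv.neg ℤ) ?_ ?_
  · intro k
    simp only [Finset.mem_Ioo, Equiv.neg_apply]
    omega
  · intro k _
    rw [star_mul, star_uPow, ← map_star, crossedHom_mul_uPow, Equiv.neg_apply, neg_neg]

theorem continuous_crossedHom (h : T ≃ₜ T) : Continuous (crossedHom h) :=
  AddMonoidHomClass.continuous_of_bound (crossedHom h) 1 fun f => by
    rw [one_mul]
    exact NonUnitalStarAlgHom.norm_apply_le (universalRep h) f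

end polySum

namespace Visits

variable {T : Type u} [MetricSpace T] {h : T ≃ₜ T} {S : Set T} {N : ℕ}

theorem continuous_coef (V : Visits h S N) {F : (orbitBase h S).Total} (hF : ∀ i, V.Compat F i)
    (k : ℤ) : Continuous (V.coef F k) := by
  rw [← continuousOn_univ]
  refine (V.continuousOn_coef (m := (orbitBase h S).l) (fun j _ => hF j) k).mono fun t _ => ?_
  obtain ⟨i, z, c, -, h1, h2, rfl⟩ := V.exists_base t
  obtain ⟨b, rfl⟩ := exists_fin_eq ⟨h1, h2⟩
  exact ⟨i, i.2, z, b, rfl⟩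

variable (V : Visits h S N)

include V in
theorem pos_of_nonempty (hne : S.Nonempty) : 0 < N := by
  obtain ⟨j, hj, -⟩ := V.exists_visit hne.some
  omega

/-- The tuple of matrix-valued functions `(c_{a - b} ∘ h ^ b)`. -/
noncomputable def ofCoef (h : T ≃ₜ T) (S : Set T) (c : ℤ → C(T, ℂ)) : (orbitBase h S).Total :=
  fun i => ⟨fun x => Matrix.of fun a b : Fin ((orbitBase h S).n i) =>
      c ((a : ℕ) - (b : ℕ)) ((h ^ ((b : ℕ) + 1 : ℤ)) (toT x)),
    continuous_matrix fun _ _ => (c _).continuous.comp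
      ((h ^ (_ : ℤ)).continuous.comp continuous_toT)⟩

theorem coef_ofCoef {c : ℤ → C(T, ℂ)} (hc : IsCoefFamily h S c) (k : ℤ) (t : T) :
    V.coef (ofCoef h S c) k t = c k t := by
  by_cases ht : Crosses h S k t
  · rw [V.coef_eq_zero _ ht, hc k t ht]
  obtain ⟨i, z, b, hz, h1, h2, rfl⟩ := V.exists_base t
  rw [V.crosses_base_iff hz h1 h2, not_not] at ht
  rw [V.coef_base _ k hz h1 h2]
  obtain ⟨a, ha⟩ := exists_fin_eq ht
  obtain ⟨b, rfl⟩ := exists_fin_eq ⟨h1, h2⟩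
  rw [ha]
  refine (ent_fin _ a b).trans ?_
  show c ((a : ℕ) - (b : ℕ)) _ = _
  rw [show ((a : ℕ) : ℤ) - (b : ℕ) = k by omega]

variable [CompactSpace T] (hne : S.Nonempty)

/-- The coefficients of an element of the algebra of the decomposition, as continuous functions. -/
noncomputable def coefC (F : (V.decomp hne).algebra) (k : ℤ) : C(T, ℂ) :=
  ⟨V.coef F.1 k, V.continuous_coef ((V.mem_algebra_iff hne F.1).1 F.2) k⟩

theorem isCoefFamily_coefC (F : (V.decomp hne).algebra) : IsCoefFamily h S (V.coefC hne F) :=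
  fun _ _ ht => V.coef_eq_zero F.1 ht

/-- The homomorphism `F ↦ ∑ u ^ k f_k` to the crossed product. -/
noncomputable def toCrossed : (V.decomp hne).algebra →⋆ₐ[ℂ] crossedProduct h where
  toAlgHom := AlgHom.ofLinearMap
    { toFun := fun F => polySum h N (V.coefC hne F)
      map_add' := fun F G => by
        rw [polySum, polySum, polySum, ← Finset.sum_add_distrib]
        refine Finset.sum_congr rfl fun k _ => ?_
        rw [← mul_add, ← map_add]
        congr 2
        ext t
        exact V.coef_add F.1 G.1 k t
      map_smul' := fun a F => by
        rw [polySum, polySum, Finset.smul_sum]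
        refine Finset.sum_congr rfl fun k _ => ?_
        rw [← mul_smul_comm, RingHom.id_apply, ← map_smul]
        congr 2
        ext t
        exact V.coef_smul a F.1 k t }
    (by
      show polySum h N _ = 1
      have h0 : (0 : ℤ) ∈ Finset.Ioo (-N : ℤ) N := by
        have := V.pos_of_nonempty hne
        rw [Finset.mem_Ioo]; omega
      have hc : ∀ k, V.coefC hne 1 k = if k = 0 then 1 else 0 := fun k => by
        ext t
        refine (V.coef_one k t).trans ?_
        split_ifs <;> rfl
      rw [polySum, Finset.sum_eq_single_of_mem 0 h0]
      · rw [hc, if_pos rfl, uPow_zero, map_one, mul_one]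
      · intro k _ hk
        rw [hc, if_neg hk, map_zero, mul_zero])
    (fun F G => by
      refine Eq.trans ?_ (polySum_mul V (V.isCoefFamily_coefC hne F)
        (V.isCoefFamily_coefC hne G)).symm
      show polySum h N _ = polySum h N _
      congr 1
      funext m
      ext t
      refine (V.coef_mul F.1 G.1 m t).trans ?_
      rw [ContinuousMap.sum_apply]
      rfl)
  map_star' F := by
    refine Eq.trans ?_ (polySum_star h N _).symm
    show polySum h N _ = polySum h N _
    congr 1
    funext k
    ext t
    exact V.coef_star F.1 k t

theorem toCrossed_apply (F : (V.decomp hne).algebra) :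
    V.toCrossed hne F = polySum h N (V.coefC hne F) := rfl

/-- At every point of `X_i`, those of `Y_i` included, the matrix is defined by the orbit formula
itself, so compatibility is automatic. -/
theorem ofCoef_mem {c : ℤ → C(T, ℂ)} (hc : IsCoefFamily h S c) :
    ofCoef h S c ∈ (V.decomp hne).algebra := by
  rw [mem_algebra_iff]
  intro i y
  ext a b
  exact V.coef_ofCoef hc _ _

theorem toCrossed_ofCoef {c : ℤ → C(T, ℂ)} (hc : IsCoefFamily h S c) :
    V.toCrossed hne ⟨ofCoef h S c, V.ofCoef_mem hne hc⟩ = polySum h N c := by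
  rw [toCrossed_apply]
  congr 1
  funext k
  ext t
  exact V.coef_ofCoef hc k t

theorem apply_eq_coef {F : (orbitBase h S).Total} (hF : F ∈ (V.decomp hne).algebra)
    (i : Fin (orbitBase h S).l) (x : (orbitBase h S).X i) (a b : Fin ((orbitBase h S).n i)) :
    F i x a b = V.coef F ((a : ℕ) - (b : ℕ)) ((h ^ ((b : ℕ) + 1 : ℤ)) (toT x)) := by
  rw [mem_algebra_iff] at hF
  rw [(hF i).coef_point _ x (by omega) (by omega), ← ent_fin (F i x : Matrix _ _ ℂ) a b]
  congr 1
  ring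

theorem toCrossed_injective : Function.Injective (V.toCrossed hne) := by
  rw [injective_iff_map_eq_zero]
  intro F hF
  have hc : ∀ k t, V.coef F.1 k t = 0 := by
    intro k t
    by_cases hk : (N : ℤ) ≤ |k|
    · exact V.coef_eq_zero_of_le F.1 hk t
    · rw [not_le, abs_lt] at hk
      have := norm_le_norm_polySum h N (V.coefC hne F) (Finset.mem_Ioo.2 hk)
      rw [← toCrossed_apply, hF, norm_zero, norm_le_zero_iff] at this
      exact congrArg (fun f : C(T, ℂ) => f t) this
  refine Subtype.ext (funext fun i => ContinuousMap.ext fun x => ?_)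
  ext a b
  exact (V.apply_eq_coef hne F.2 i x a b).trans (hc _ _)

theorem range_toCrossed :
    Set.range (V.toCrossed hne) = {a | ∃ c, IsCoefFamily h S c ∧ polySum h N c = a} := by
  ext a
  constructor
  · rintro ⟨F, rfl⟩
    exact ⟨_, V.isCoefFamily_coefC hne F, rfl⟩
  · rintro ⟨c, hc, rfl⟩
    exact ⟨_, V.toCrossed_ofCoef hne hc⟩

/-- On finite tuples of coefficients the sum is continuous and bounded below by
`norm_le_norm_polySum`, hence a closed embedding. The vanishing conditions define a closed set of
tuples. -/
theorem isClosed_range_toCrossed : IsClosed (Set.range (V.toCrossed hne)) := by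
  let I := {k : ℤ // k ∈ Finset.Ioo (-N : ℤ) N}
  let E : (I → C(T, ℂ)) → ℤ → C(T, ℂ) := fun d k =>
    if hk : k ∈ Finset.Ioo (-N : ℤ) N then d ⟨k, hk⟩ else 0
  let L : (I → C(T, ℂ)) →+ crossedProduct h :=
    { toFun := fun d => ∑ k : I, uPow h k.1 * crossedHom h (d k)
      map_zero' := by simp
      map_add' := fun d e => by simp [mul_add, Finset.sum_add_distrib] }
  have hL : ∀ d, L d = polySum h N (E d) := fun d => by
    rw [polySum, ← Finset.sum_coe_sort (Finset.Ioo (-N : ℤ) N)]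
    show ∑ k : I, uPow h k.1 * crossedHom h (d k) = ∑ k : I, uPow h k.1 * crossedHom h (E d k.1)
    simp only [E, dif_pos (Subtype.prop _)]
    rfl
  have hLc : Continuous L :=
    continuous_finsetSum (f := fun (k : I) (d : I → C(T, ℂ)) => uPow h k.1 * crossedHom h (d k))
      Finset.univ fun k _ =>
        continuous_const.mul ((continuous_crossedHom h).comp (continuous_apply k))
  have hLa : AntilipschitzWith 1 L := AddMonoidHomClass.antilipschitz_of_bound L fun d => by
    rw [NNReal.coe_one, one_mul, hL]
    refine (pi_norm_le_iff_of_nonneg (norm_nonneg _)).2 fun k => ?_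
    have := norm_le_norm_polySum h N (E d) k.2
    simpa only [E, dif_pos k.2] using this
  have hemb : Topology.IsClosedEmbedding L :=
    hLa.isClosedEmbedding (uniformContinuous_addMonoidHom_of_continuous hLc)
  have hcl : IsClosed {d : I → C(T, ℂ) | ∀ k t, Crosses h S k.1 t → d k t = 0} := by
    simp only [Set.ofPred_forall]
    refine isClosed_iInter fun k => isClosed_iInter fun t => isClosed_iInter fun _ => ?_
    exact isClosed_eq ((continuous_eval_const t).comp (continuous_apply k))
      continuous_const
  convert hemb.isClosedMap _ hcl using 1
  rw [range_toCrossed]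
  ext a
  constructor
  · rintro ⟨c, hc, rfl⟩
    refine ⟨fun k => c k.1, fun k t ht => hc k.1 t ht, ?_⟩
    rw [hL]
    refine Finset.sum_congr rfl fun k hk => ?_
    simp only [E, dif_pos hk]
  · rintro ⟨d, hd, rfl⟩
    refine ⟨E d, fun k t ht => ?_, (hL d).symm⟩
    by_cases hk : k ∈ Finset.Ioo (-N : ℤ) N
    · simp only [E, dif_pos hk]
      exact hd ⟨k, hk⟩ t ht
    · simp only [E, dif_neg hk]
      rfl

end Visits

/-! ### The orbit-breaking algebra as an algebra of coefficient families -/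

section Crossings

variable {T : Type u} [TopologicalSpace T] {h : T ≃ₜ T} {S : Set T}

theorem isCoefFamily_single {k : ℤ} {f : C(T, ℂ)} (hf : ∀ t, Crosses h S k t → f t = 0) :
    IsCoefFamily h S (Pi.single k f) := by
  intro j t ht
  by_cases hj : j = k
  · subst hj
    rw [Pi.single_eq_same]
    exact hf t ht
  · rw [Pi.single_eq_of_ne hj]
    rfl

theorem crosses_zero (t : T) : ¬ Crosses h S 0 t := fun ⟨j, h1, h2, _⟩ => by omega

theorem mem_of_crosses_one {t : T} (ht : Crosses h S 1 t) : t ∈ S := by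
  obtain ⟨j, h1, h2, h3⟩ := ht
  obtain rfl : j = 0 := by omega
  rwa [zpow_zero_apply] at h3

end Crossings

section Generators

variable {T : Type u} [MetricSpace T] [CompactSpace T] (h : T ≃ₜ T) (S : Set T)

theorem isClosed_orbitBreaking : IsClosed (orbitBreaking h S : Set (crossedProduct h)) :=
  StarSubalgebra.isClosed_topologicalClosure _

theorem crossedHom_mem (f : C(T, ℂ)) : crossedHom h f ∈ orbitBreaking h S := (genF h S f).2

theorem crossedU_mul_mem {g : C(T, ℂ)} (hg : ∀ s ∈ S, g s = 0) :
    crossedU h * crossedHom h g ∈ orbitBreaking h S := (genU h S g hg).2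

/-- The function `|f| / (|f| + ε)`. -/
noncomputable def cutoff (f : C(T, ℂ)) {ε : ℝ} (hε : 0 < ε) : C(T, ℂ) :=
  ⟨fun t => ((‖f t‖ / (‖f t‖ + ε) : ℝ) : ℂ), Complex.continuous_ofReal.comp
    (f.continuous.norm.div (f.continuous.norm.add continuous_const) fun t => by positivity)⟩

theorem norm_sub_mul_cutoff_le (f : C(T, ℂ)) {ε : ℝ} (hε : 0 < ε) :
    ‖f - f * cutoff f hε‖ ≤ ε := by
  refine (ContinuousMap.norm_le _ hε.le).2 fun t => ?_
  have h0 : 0 < ‖f t‖ + ε := by positivity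
  have e : (f - f * cutoff f hε) t = f t * ((ε / (‖f t‖ + ε) : ℝ) : ℂ) := by
    show f t - f t * ((‖f t‖ / (‖f t‖ + ε) : ℝ) : ℂ) = _
    rw [← mul_one_sub, ← Complex.ofReal_one, ← Complex.ofReal_sub]
    congr 2
    field_simp
    ring
  rw [e, norm_mul, Complex.norm_real, Real.norm_of_nonneg (by positivity), mul_div_assoc',
    div_le_iff₀ h0]
  nlinarith [norm_nonneg (f t)]

variable {S}

/-- Up to a small error `f` is `f * cutoff f`, and `u^(k+1) f cutoff(f) = (u^k (f ∘ h⁻¹)) (u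
cutoff(f))`. The second factor is a generator because `f`, and with it the cutoff, vanishes on `S`;
the first is covered by induction. -/
theorem uPow_natCast_mul_mem (k : ℕ) {f : C(T, ℂ)} (hf : ∀ t, Crosses h S k t → f t = 0) :
    uPow h k * crossedHom h f ∈ orbitBreaking h S := by
  induction k generalizing f with
  | zero =>
    rw [Nat.cast_zero, uPow_zero, one_mul]
    exact crossedHom_mem h S f
  | succ k ih =>
    have hcl : IsClosed {g : C(T, ℂ) | uPow h (k + 1 : ℕ) * crossedHom h g ∈ orbitBreaking h S} :=
      (isClosed_orbitBreaking h S).preimage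
        (continuous_const.mul (continuous_crossedHom h))
    refine hcl.closure_subset_iff.2 subset_rfl (Metric.mem_closure_iff.2 fun ε hε => ?_)
    refine ⟨f * cutoff f (half_pos hε), ?_, ?_⟩
    swap
    · rw [dist_eq_norm]
      exact (norm_sub_mul_cutoff_le f (half_pos hε)).trans_lt (half_lt_self hε)
    have e : twist h 1 (twist h (-1) f) = f := by
      rw [← twist_add]
      ext t
      exact congrArg f (zpow_zero_apply h t)
    have e2 : uPow h (k + 1 : ℕ) * crossedHom h (f * cutoff f (half_pos hε)) =
        (uPow h k * crossedHom h (twist h (-1) f)) *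
          (crossedU h * crossedHom h (cutoff f (half_pos hε))) := by
      rw [← uPow_one, mul_assoc, ← mul_assoc (crossedHom h _) (uPow h 1), crossedHom_mul_uPow, e,
        map_mul, Nat.cast_succ, uPow_add]
      simp only [mul_assoc]
    show uPow h (k + 1 : ℕ) * crossedHom h (f * cutoff f (half_pos hε)) ∈ orbitBreaking h S
    rw [e2]
    refine mul_mem (ih fun t ht => hf _ ?_) (crossedU_mul_mem h S fun s hs => ?_)
    · obtain ⟨j, h1, h2, h3⟩ := ht
      refine ⟨j + 1, by omega, by omega, ?_⟩
      show (h ^ (j + 1)) ((h ^ (-1 : ℤ)) t) ∈ S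
      rwa [← zpow_add_apply, add_neg_cancel_right]
    · have : f s = 0 := hf s ⟨0, by omega, by omega, by rwa [zpow_zero_apply]⟩
      show ((‖f s‖ / (‖f s‖ + ε / 2) : ℝ) : ℂ) = 0
      rw [this, norm_zero, zero_div, Complex.ofReal_zero]

theorem uPow_mul_mem (k : ℤ) {f : C(T, ℂ)} (hf : ∀ t, Crosses h S k t → f t = 0) :
    uPow h k * crossedHom h f ∈ orbitBreaking h S := by
  obtain ⟨k, rfl | rfl⟩ := k.eq_nat_or_neg
  · exact uPow_natCast_mul_mem h k hf
  · rw [← star_star (uPow h (-k) * crossedHom h f)]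
    refine star_mem ?_
    rw [star_mul, star_uPow, neg_neg, ← map_star, crossedHom_mul_uPow]
    refine uPow_natCast_mul_mem h k fun t ht => ?_
    show star (f ((h ^ (k : ℤ)) t)) = 0
    rw [hf, star_zero]
    obtain ⟨j, h1, h2, h3⟩ := ht
    refine ⟨j - k, by omega, by omega, ?_⟩
    rwa [← zpow_add_apply, sub_add_cancel]

variable {h}

theorem polySum_single {N : ℕ} (V : Visits h S N) {k : ℤ} {f : C(T, ℂ)}
    (hf : ∀ t, Crosses h S k t → f t = 0) :
    polySum h N (Pi.single k f) = uPow h k * crossedHom h f := by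
  rw [polySum, Finset.sum_eq_single k, Pi.single_eq_same]
  · intro j _ hj
    rw [Pi.single_eq_of_ne hj, map_zero, mul_zero]
  · intro hk
    -- Outside the range of summation every segment crosses `S`, so `f = 0` and nothing is lost.
    have hk' : (N : ℤ) ≤ |k| := by
      rw [Finset.mem_Ioo, ← abs_lt] at hk
      exact not_lt.1 hk
    have : f = 0 := ContinuousMap.ext fun t => hf t (V.crosses_of_le hk' t)
    rw [Pi.single_eq_same, this, map_zero, mul_zero]

end Generators

namespace Visits

variable {T : Type u} [MetricSpace T] [CompactSpace T] {h : T ≃ₜ T} {S : Set T} {N : ℕ}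
  (V : Visits h S N) (hne : S.Nonempty)

theorem toCrossed_mem (F : (V.decomp hne).algebra) : V.toCrossed hne F ∈ orbitBreaking h S := by
  rw [toCrossed_apply, polySum]
  exact sum_mem fun k _ => uPow_mul_mem h k fun t ht => V.isCoefFamily_coefC hne F k t ht

/-- The generators `f` and `u g` are coefficient families concentrated in degrees `0` and `1`, and
the range is closed. -/
theorem orbitBreaking_le_range : orbitBreaking h S ≤ (V.toCrossed hne).range := by
  refine StarSubalgebra.topologicalClosure_minimal (StarAlgebra.adjoin_le ?_) ?_
  · rintro a (⟨f, rfl⟩ | ⟨g, hg, rfl⟩)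
    · have hf : ∀ t, Crosses h S 0 t → f t = 0 := fun t ht => absurd ht (crosses_zero t)
      refine ⟨_, (V.toCrossed_ofCoef hne (isCoefFamily_single hf)).trans ?_⟩
      rw [polySum_single V hf, uPow_zero, one_mul]
      rfl
    · have hf : ∀ t, Crosses h S 1 t → g t = 0 := fun t ht => hg t (mem_of_crosses_one ht)
      refine ⟨_, (V.toCrossed_ofCoef hne (isCoefFamily_single hf)).trans ?_⟩
      rw [polySum_single V hf, uPow_one]
      rfl
  · exact V.isClosed_range_toCrossed hne

/-- The identification of the algebra of the decomposition with the orbit-breaking algebra. -/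
noncomputable def algebraEquiv : (V.decomp hne).algebra ≃⋆ₐ[ℂ] orbitBreaking h S :=
  StarAlgEquiv.ofBijective ((V.toCrossed hne).codRestrict (orbitBreaking h S) (V.toCrossed_mem hne))
    ⟨fun _ _ e => V.toCrossed_injective hne (congrArg Subtype.val e), fun a => by
      obtain ⟨F, hF⟩ := V.orbitBreaking_le_range hne a.2
      exact ⟨F, Subtype.ext hF⟩⟩

theorem algebraEquiv_symm_eq {a : orbitBreaking h S} {c : ℤ → C(T, ℂ)} (hc : IsCoefFamily h S c)
    (ha : a.1 = polySum h N c) : ((V.algebraEquiv hne).symm a).1 = ofCoef h S c := by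
  have : (V.algebraEquiv hne).symm a = ⟨ofCoef h S c, V.ofCoef_mem hne hc⟩ := by
    rw [StarAlgEquiv.symm_apply_eq]
    exact Subtype.ext (ha.trans (V.toCrossed_ofCoef hne hc).symm)
  rw [this]

theorem isCanonicalIso : IsCanonicalIso h S (V.decomp hne) (V.algebraEquiv hne).symm where
  apply_f f i x := by
    have hf : ∀ t, Crosses h S 0 t → f t = 0 := fun t ht => absurd ht (crosses_zero t)
    rw [V.algebraEquiv_symm_eq hne (isCoefFamily_single hf) (by
      rw [polySum_single V hf, uPow_zero, one_mul]; rfl)]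
    ext a b
    show (Pi.single 0 f : ℤ → C(T, ℂ)) ((a : ℕ) - (b : ℕ)) ((h ^ ((b : ℕ) + 1 : ℤ)) (toT x)) = _
    by_cases hab : a = b
    · subst hab
      rw [sub_self, Pi.single_eq_same, Matrix.diagonal_apply_eq, ← Nat.cast_succ,
        zpow_natCast_apply]
      rfl
    · rw [Matrix.diagonal_apply_ne _ hab, Pi.single_eq_of_ne]
      · rfl
      · intro e
        exact hab (Fin.ext (by omega))
  apply_ug g hg i x := by
    have hf : ∀ t, Crosses h S 1 t → g t = 0 := fun t ht => hg t (mem_of_crosses_one ht)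
    rw [V.algebraEquiv_symm_eq hne (isCoefFamily_single hf) (by
      rw [polySum_single V hf, uPow_one]; rfl)]
    ext a b
    show (Pi.single 1 g : ℤ → C(T, ℂ)) ((a : ℕ) - (b : ℕ)) ((h ^ ((b : ℕ) + 1 : ℤ)) (toT x)) = _
    rw [Matrix.of_apply]
    by_cases hab : a.1 = b.1 + 1
    · rw [if_pos hab, show ((a : ℕ) : ℤ) - (b : ℕ) = 1 by omega, Pi.single_eq_same,
        ← Nat.cast_succ, zpow_natCast_apply]
      rfl
    · rw [if_neg hab, Pi.single_eq_of_ne]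
      · rfl
      · intro e
        exact hab (by omega)

end Visits

/-! ### The inclusion for `R ⊆ S` -/

theorem IsCoefFamily.anti {T : Type u} [TopologicalSpace T] {h : T ≃ₜ T} {R S : Set T}
    (hRS : R ⊆ S) {c : ℤ → C(T, ℂ)} (hc : IsCoefFamily h S c) : IsCoefFamily h R c :=
  fun k t ht => hc k t (ht.mono hRS)

theorem orbitBreaking_anti {T : Type u} [MetricSpace T] [CompactSpace T] (h : T ≃ₜ T)
    {R S : Set T} (hRS : R ⊆ S) : orbitBreaking h S ≤ orbitBreaking h R :=
  StarSubalgebra.topologicalClosure_mono (StarAlgebra.adjoin_mono (Set.union_subset_union_right _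
    fun _ ⟨g, hg, e⟩ => ⟨g, fun s hs => hg s (hRS hs), e⟩))

theorem mainTheorem7 {T : Type u} [MetricSpace T] [CompactSpace T] [Infinite T]
    (h : T ≃ₜ T) (hmin : IsMinimalHomeo h) (R S : Set T)
    (hR : IsClosed R) (hS : IsClosed S) (hRne : (interior R).Nonempty)
    (hSne : (interior S).Nonempty) (hRS : R ⊆ S) :
    (returnTimes h S).Finite ∧ (returnTimes h R).Finite ∧
    ∃ (hle : orbitBreaking h S ≤ orbitBreaking h R)
      (DS : RSHDecomp (orbitBase h S)) (DR : RSHDecomp (orbitBase h R))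
      (γS : orbitBreaking h S ≃⋆ₐ[ℂ] DS.algebra) (γR : orbitBreaking h R ≃⋆ₐ[ℂ] DR.algebra),
      DS.IsDSH ∧ DR.IsDSH ∧ IsOrbitDecomp h S DS ∧ IsOrbitDecomp h R DR ∧
      IsCanonicalIso h S DS γS ∧ IsCanonicalIso h R DR γR ∧
      ∃ ψ : DS.algebra →⋆ₐ[ℂ] DR.algebra,
        (∀ a : orbitBreaking h S, ψ (γS a) = γR (StarSubalgebra.inclusion hle a)) ∧
        RSHDecomp.IsDiagonalMap ψ ∧
        ∀ (i : Fin (orbitBase h R).l) (x : (orbitBase h R).X i), x ∉ (orbitBase h R).Y i →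
          ∃ (q : ℕ) (idx : Fin q → Fin (orbitBase h S).l)
            (pts : ∀ j, (orbitBase h S).X (idx j)),
            IsItinerary h S (Subtype.val x) ((orbitBase h R).n i) idx pts ∧
              RSHDecomp.MapDecomposesInto ψ i x idx pts := by
  obtain ⟨N, VR⟩ := hmin.exists_visits hR hRne
  have VS : Visits h S N := VR.mono hRS hS
  have neR : R.Nonempty := hRne.mono interior_subset
  have neS : S.Nonempty := hSne.mono interior_subset
  have hle := orbitBreaking_anti h hRS
  let ψ : (VS.decomp neS).algebra →⋆ₐ[ℂ] (VR.decomp neR).algebra :=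
    ((VR.algebraEquiv neR).symm : orbitBreaking h R →⋆ₐ[ℂ] (VR.decomp neR).algebra).comp
      ((StarSubalgebra.inclusion hle).comp
        (VS.algebraEquiv neS : (VS.decomp neS).algebra →⋆ₐ[ℂ] orbitBreaking h S))
  -- The inclusion does not change the element `∑ u^k f_k`, so the image under `ψ` is given by the
  -- coefficients of `F` for `S`, arranged along the return segments of `R`.
  have hψ : ∀ F i (x : (orbitBase h R).X i),
      (ψ F).1 i x = VS.orbitMatrix F.1 (Visits.toT x) ((orbitBase h R).n i) := by
    intro F i x
    have e : (ψ F).1 = Visits.ofCoef h R (VS.coefC neS F) :=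
      VR.algebraEquiv_symm_eq neR ((VS.isCoefFamily_coefC neS F).anti hRS) rfl
    rw [e]
    rfl
  -- Every `x ∈ X_i^R`, also in `Y_i^R`, has `x` and `h^(n_i) x` in `R ⊆ S`. So the segment is a
  -- concatenation of return segments of `S`, and diagonality holds at all points.
  have hdec : ∀ (i : Fin (orbitBase h R).l) (x : (orbitBase h R).X i),
      ∃ (q : ℕ) (idx : Fin q → Fin (orbitBase h S).l) (pts : ∀ j, (orbitBase h S).X (idx j)),
        IsItinerary h S (Subtype.val x) ((orbitBase h R).n i) idx pts ∧
          RSHDecomp.MapDecomposesInto ψ i x idx pts := by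
    intro i x
    obtain ⟨h1, h2⟩ := VR.base_mem x
    obtain ⟨q, idx, pts, hI⟩ := VS.exists_itinerary (hRS h1) (VR.n_pos i) (hRS h2)
    refine ⟨q, idx, pts, hI, fun F => ?_⟩
    rw [hψ]
    exact VS.isBlockDiag_orbitMatrix hI F.1
  refine ⟨VS.returnTimes_finite, VR.returnTimes_finite, hle, VS.decomp neS, VR.decomp neR,
    (VS.algebraEquiv neS).symm, (VR.algebraEquiv neR).symm, VS.isDSH neS, VR.isDSH neR,
    VS.isOrbitDecomp neS, VR.isOrbitDecomp neR, VS.isCanonicalIso neS, VR.isCanonicalIso neR,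
    ψ, fun a => ?_, fun i z => ?_, fun i x _ => hdec i x⟩
  · show (VR.algebraEquiv neR).symm (StarSubalgebra.inclusion hle
      (VS.algebraEquiv neS ((VS.algebraEquiv neS).symm a))) = _
    rw [StarAlgEquiv.apply_symm_apply]
  · obtain ⟨q, idx, pts, _, hD⟩ := hdec i z
    exact ⟨q, idx, pts, hD⟩
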